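/- Let $\Gamma$ be a group. For a finite abelian group $S$, let $\Sigma(\Gamma,S)$ be the Bernoulli shift, i.e. the compact abelian group of all functions $\tau:\Gamma\to S$ with the product topology ($S$ discrete) and the action $(\gamma\cdot\tau)(\gamma')=\tau(\gamma'\gamma)$ of $\Gamma$. A linear subshift is a closed $\Gamma$-invariant subgroup of some $\Sigma(\Gamma,S)$. The group $\Gamma$ is called SEA (symbolically entropy additive) if: (A1) there is a real-valued function $h$ on the linear subshifts (over all finite abelian groups $S$) such that (A2) $h(\Sigma(\Gamma,S))=\log_2|S|$ for every finite abelian group $S$; (A3) if $\phi_1\subset\phi_2\subset\Sigma(\Gamma,S)$ are linear subshifts, then $0\le h(\phi_1)\le h(\phi_2)$; (A4) if $\phi_1\subset\Sigma(\Gamma,S_1)$ and $\phi_2\subset\Sigma(\Gamma,S_2)$ are linear subshifts and there is a $\Gamma$-equivariant homeomorphism $\phi_1\to\phi_2$, then $h(\phi_1)=h(\phi_2)$; (A5) if a linear subshift $\phi$ has only finitely many elements, then $h(\phi)=0$; (A6) (Yuzvinskii axiom) if $T:\phi_1\to\phi_2$ is a surjective continuous $\Gamma$-equivariant group homomorphism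 between linear subshifts, then $h(\ker T)+h(\phi_2)=h(\phi_1)$. The group $\Gamma$ is of finite type if it has a finite simplicial classifying space, i.e. a finite simplicial complex $B\Gamma$ with fundamental group $\Gamma$ (so that $\Gamma$ is the deck transformation group of its universal cover $E\Gamma$) such that $E\Gamma$ is contractible. The homotopy type of $B\Gamma$ depends only on $\Gamma$, and $e(\Gamma)=\chi(B\Gamma)=\sum_{\sigma}(-1)^{\dim\sigma}$, the sum over the simplices $\sigma$ of $B\Gamma$, is the Euler characteristic of $\Gamma$. **Theorem.** If $\Gamma$ is a group of finite type and $e(\Gamma)\neq 0$ (that is, $\chi(B\Gamma)\ne0$ for some finite simplicial classifying space $B\Gamma$ of $\Gamma$), then $\Gamma$ is not SEA. -/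

import Mathlib

open Topology

/-! ### Bernoulli shifts and linear subshifts -/

/-- The Bernoulli shift `Σ(Γ, S)`: the group of all `S`-valued functions on `Γ`. -/
def BernoulliShift (Γ S : Type*) : Type _ := Γ → S

namespace BernoulliShift

instance (Γ S : Type*) [AddCommGroup S] : AddCommGroup (BernoulliShift Γ S) :=
  inferInstanceAs (AddCommGroup (Γ → S))

/-- The product topology, where each factor `S` is discrete. -/
instance (Γ S : Type*) : TopologicalSpace (BernoulliShift Γ S) :=
  @Pi.topologicalSpace Γ (fun _ => S) (fun _ => ⊥)

instance (Γ S : Type*) : T2Space (BernoulliShift Γ S) :=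
  letI : TopologicalSpace S := ⊥
  haveI : DiscreteTopology S := ⟨rfl⟩
  inferInstanceAs (T2Space (Γ → S))

/-- The left action `(γ • τ)(γ') = τ(γ' γ)`. -/
instance (Γ S : Type*) [Monoid Γ] : MulAction Γ (BernoulliShift Γ S) where
  smul γ τ := fun γ' => τ (γ' * γ)
  one_smul τ := funext fun γ' => congrArg τ (mul_one γ')
  mul_smul a b τ := funext fun γ' => congrArg τ (mul_assoc γ' a b).symm

theorem smul_apply {Γ S : Type*} [Monoid Γ] (γ γ' : Γ) (τ : BernoulliShift Γ S) :
    (γ • τ) γ' = τ (γ' * γ) := rfl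

theorem smul_zero {Γ S : Type*} [Monoid Γ] [AddCommGroup S] (γ : Γ) :
    γ • (0 : BernoulliShift Γ S) = 0 := rfl

end BernoulliShift

/-- A linear subshift: a closed `Γ`-invariant subgroup of the Bernoulli shift `Σ(Γ, S)`. -/
structure LinearSubshift (Γ S : Type*) [Monoid Γ] [AddCommGroup S] where
  /-- the underlying subgroup -/
  toAddSubgroup : AddSubgroup (BernoulliShift Γ S)
  isClosed : IsClosed (toAddSubgroup : Set (BernoulliShift Γ S))
  smul_mem : ∀ (γ : Γ) {τ : BernoulliShift Γ S}, τ ∈ toAddSubgroup → γ • τ ∈ toAddSubgroup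

namespace LinearSubshift

/-- The points of a linear subshift, as a topological group with the topology induced from the
Bernoulli shift. -/
abbrev Points {Γ S : Type*} [Monoid Γ] [AddCommGroup S] (φ : LinearSubshift Γ S) : Type _ :=
  φ.toAddSubgroup

instance {Γ S : Type*} [Monoid Γ] [AddCommGroup S] (φ : LinearSubshift Γ S) :
    MulAction Γ φ.Points where
  smul γ τ := ⟨γ • (τ : BernoulliShift Γ S), φ.smul_mem γ τ.2⟩
  one_smul τ := Subtype.ext (one_smul Γ (τ : BernoulliShift Γ S))
  mul_smul a b τ := Subtype.ext (mul_smul a b (τ : BernoulliShift Γ S))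

theorem coe_smul {Γ S : Type*} [Monoid Γ] [AddCommGroup S] (φ : LinearSubshift Γ S) (γ : Γ)
    (τ : φ.Points) : ((γ • τ : φ.Points) : BernoulliShift Γ S) = γ • (τ : BernoulliShift Γ S) :=
  rfl

/-- The full Bernoulli shift as a linear subshift of itself. -/
def full (Γ S : Type*) [Monoid Γ] [AddCommGroup S] : LinearSubshift Γ S where
  toAddSubgroup := ⊤
  isClosed := isClosed_univ
  smul_mem _ _ _ := trivial

/-- The kernel of a continuous equivariant homomorphism `T : φ₁ → φ₂` of linear subshifts; it is a
linear subshift of the Bernoulli shift containing `φ₁`. -/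
def ker {Γ S₁ S₂ : Type*} [Monoid Γ] [AddCommGroup S₁] [AddCommGroup S₂]
    {φ₁ : LinearSubshift Γ S₁} {φ₂ : LinearSubshift Γ S₂} (T : φ₁.Points →+ φ₂.Points)
    (hT : Continuous T) (hequiv : ∀ (γ : Γ) (τ : φ₁.Points), T (γ • τ) = γ • T τ) :
    LinearSubshift Γ S₁ where
  toAddSubgroup := T.ker.map φ₁.toAddSubgroup.subtype
  isClosed := by
    have h : IsClosed (T ⁻¹' {0}) := isClosed_singleton.preimage hT
    exact φ₁.isClosed.isClosedEmbedding_subtypeVal.isClosedMap _ h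
  smul_mem := by
    rintro γ _ ⟨τ, hτ, rfl⟩
    refine ⟨γ • τ, ?_, rfl⟩
    have h0 : T τ = 0 := hτ
    change T (γ • τ) = 0
    rw [hequiv, h0]
    exact Subtype.ext (BernoulliShift.smul_zero γ)

end LinearSubshift

/-! ### Symbolically entropy additive groups -/

/-- A real-valued function on all linear subshifts over `Γ` (with arbitrary finite abelian
alphabet) satisfying the axioms of an entropy that obeys the addition formula. -/
structure AdditiveEntropy (Γ : Type*) [Monoid Γ] where
  /-- (A1) the entropy function -/
  h : ∀ {S : Type} [AddCommGroup S] [Finite S], LinearSubshift Γ S → ℝ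
  /-- (A2) -/
  h_full : ∀ (S : Type) [AddCommGroup S] [Finite S],
    h (LinearSubshift.full Γ S) = Real.logb 2 (Nat.card S)
  /-- (A3) -/
  h_mono : ∀ {S : Type} [AddCommGroup S] [Finite S] (φ₁ φ₂ : LinearSubshift Γ S),
    φ₁.toAddSubgroup ≤ φ₂.toAddSubgroup → 0 ≤ h φ₁ ∧ h φ₁ ≤ h φ₂
  /-- (A4) invariance under topological conjugacy -/
  h_homeomorph : ∀ {S₁ S₂ : Type} [AddCommGroup S₁] [Finite S₁] [AddCommGroup S₂] [Finite S₂]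
    (φ₁ : LinearSubshift Γ S₁) (φ₂ : LinearSubshift Γ S₂) (T : φ₁.Points ≃ₜ φ₂.Points),
    (∀ (γ : Γ) (τ : φ₁.Points), T (γ • τ) = γ • T τ) → h φ₁ = h φ₂
  /-- (A5) -/
  h_finite : ∀ {S : Type} [AddCommGroup S] [Finite S] (φ : LinearSubshift Γ S),
    Finite φ.Points → h φ = 0
  /-- (A6) the Yuzvinskii axiom -/
  h_add : ∀ {S₁ S₂ : Type} [AddCommGroup S₁] [Finite S₁] [AddCommGroup S₂] [Finite S₂]
    (φ₁ : LinearSubshift Γ S₁) (φ₂ : LinearSubshift Γ S₂) (T : φ₁.Points →+ φ₂.Points)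
    (hT : Continuous T) (hequiv : ∀ (γ : Γ) (τ : φ₁.Points), T (γ • τ) = γ • T τ),
    Function.Surjective T → h (LinearSubshift.ker T hT hequiv) + h φ₂ = h φ₁

/-- `Γ` is symbolically entropy additive (SEA). -/
def IsSEA (Γ : Type*) [Monoid Γ] : Prop := Nonempty (AdditiveEntropy Γ)

/-! ### Groups of finite type -/

/-- A finite simplicial classifying space `BΓ` of a group `Γ`: a finite simplicial complex in some
Euclidean space whose universal cover `EΓ`, with deck transformation group `Γ`, is contractible. -/
structure FiniteClassifyingComplex (Γ : Type*) [Group Γ] where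
  /-- dimension of the ambient Euclidean space -/
  dim : ℕ
  /-- the simplicial complex -/
  complex : Geometry.SimplicialComplex ℝ (EuclideanSpace ℝ (Fin dim))
  finite_faces : complex.faces.Finite
  exists_contractible_cover : ∃ (E : Type) (_ : TopologicalSpace E) (_ : MulAction Γ E)
    (p : E → complex.space), ContractibleSpace E ∧ IsQuotientCoveringMap p Γ

namespace FiniteClassifyingComplex

/-- The Euler characteristic `χ(BΓ) = ∑ (-1)^(dim σ)`, over the simplices `σ` of `BΓ`; a simplex
with vertex set `s` has dimension `|s| - 1`, and `s` is nonempty. -/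
noncomputable def eulerChar {Γ : Type*} [Group Γ] (B : FiniteClassifyingComplex Γ) : ℤ :=
  ∑ s ∈ B.finite_faces.toFinset, (-1 : ℤ) ^ (s.card - 1)

/-- The fundamental group of `BΓ` is `Γ`. -/
theorem nonempty_fundamentalGroup_mulEquiv {Γ : Type*} [Group Γ] (B : FiniteClassifyingComplex Γ)
    (x : B.complex.space) : Nonempty (FundamentalGroup B.complex.space x ≃* Γ) := by
  obtain ⟨E, _, _, p, hE, hp⟩ := B.exists_contractible_cover
  obtain ⟨e, he⟩ := hp.surjective x
  exact ⟨(hp.fundamentalGroupEquiv ⟨e, he⟩).trans (MulEquiv.inv' Γ).symm⟩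

end FiniteClassifyingComplex

/-! ### Mod 2 chains on lists and on finite sets -/

/-! Lift the triangulation of `BΓ` to `E`. Because `Γ` acts freely on the nonempty lifted simplices,
with one orbit for each simplex of `BΓ`, the mod 2 cochains on simplices of even dimension form a
Bernoulli shift with alphabet `(ZMod 2)^a`, and those on simplices of odd dimension one with
alphabet `(ZMod 2)^b`, where `a` and `b` count the simplices of `BΓ` of even and odd dimension. The
coboundary is a continuous equivariant homomorphism each way, and contractibility makes the complex
exact except for the constants in degree zero. The Yuzvinskii axiom, applied to both coboundaries
and to the quotient of the even cocycles by the even coboundaries, which is finite and so has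
entropy zero, gives `a = b`, that is, `χ(BΓ) = a - b = 0`. This count is
`OrbitLabelling.natCard_orbits_eq`.

Exactness is proved directly in `exists_boundary_eq_of_contractible`. A simplicial cycle is
subdivided into ordered chains of nearby points, moved to a constant by the contraction of `E` in
small time steps, and the swept-out lists are pushed back to simplices by a map sending each point
to a nearby vertex. Subdividing and pushing back sends each simplex into its own faces, hence is the
identity (`SetChain.eq_single_of_carried`), so the pushed-back chain bounds the original cycle.
Duality over the field `ZMod 2` turns acyclicity for chains into exactness for cochains
(`exists_coboundary_eq`). The empty simplex is kept among the chains, so that all exactness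
statements are augmented and need no exception in low degree. -/

theorem Finsupp.map_mem_of_mem_supported {α R M : Type*} [Semiring R] [AddCommMonoid M] [Module R M]
    (f : (α →₀ R) →ₗ[R] M) {A : Set α} {N : Submodule R M}
    (h : ∀ a ∈ A, f (Finsupp.single a 1) ∈ N) {c : α →₀ R} (hc : c ∈ Finsupp.supported R R A) :
    f c ∈ N := by
  rw [Finsupp.supported_eq_span_single] at hc
  have : Submodule.span R ((fun i => Finsupp.single i (1 : R)) '' A) ≤ N.comap f :=
    Submodule.span_le.2 (by rintro _ ⟨a, ha, rfl⟩; exact h a ha)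
  exact this hc

theorem Finsupp.eqOn_supported {α R M : Type*} [Semiring R] [AddCommMonoid M] [Module R M]
    {f g : (α →₀ R) →ₗ[R] M} {A : Set α}
    (h : ∀ a ∈ A, f (Finsupp.single a 1) = g (Finsupp.single a 1)) {c : α →₀ R}
    (hc : c ∈ Finsupp.supported R R A) : f c = g c := by
  rw [Finsupp.supported_eq_span_single] at hc
  have : Submodule.span R ((fun i => Finsupp.single i (1 : R)) '' A) ≤ LinearMap.eqLocus f g :=
    Submodule.span_le.2 (by rintro _ ⟨a, ha, rfl⟩; exact h a ha)
  exact this hc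

/-- Mod 2 chains spanned by lists, i.e. ordered simplices of all dimensions, including the
empty one. -/
abbrev ListChain (V : Type*) : Type _ := List V →₀ ZMod 2

/-- Mod 2 chains spanned by finite sets, i.e. simplices of all dimensions, including the
empty one. -/
abbrev SetChain (V : Type*) : Type _ := Finset V →₀ ZMod 2

/-! ### Ordered chains: cones, prisms and the filling of deformable cycles. -/

namespace ListChain

variable {V W : Type*}

/-- The cone operator `l ↦ a :: l`. -/
noncomputable def cone (a : V) : ListChain V →ₗ[ZMod 2] ListChain V :=
  Finsupp.lmapDomain _ _ (List.cons a)

@[simp] theorem cone_single (a : V) (l : List V) (r : ZMod 2) :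
    cone a (Finsupp.single l r) = Finsupp.single (a :: l) r := by
  simp [cone]

/-- The boundary of an ordered simplex. -/
noncomputable def boundaryAux : List V → ListChain V
  | [] => 0
  | a :: l => Finsupp.single l 1 + cone a (boundaryAux l)

/-- The boundary operator, which deletes the entries of a list one at a time. -/
noncomputable def boundary : ListChain V →ₗ[ZMod 2] ListChain V :=
  Finsupp.linearCombination (ZMod 2) boundaryAux

@[simp] theorem boundary_nil : boundary (Finsupp.single ([] : List V) 1) = 0 := by
  simp [boundary, boundaryAux]

/-- Deleting the apex returns `c`; deleting any other entry commutes with coning. The empty list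
makes this hold for vertices too. -/
theorem boundary_cone (a : V) (c : ListChain V) :
    boundary (cone a c) = c + cone a (boundary c) := by
  have : boundary ∘ₗ cone a = LinearMap.id + cone a ∘ₗ boundary := by
    ext1 l
    ext1
    simp [boundary, boundaryAux]
  exact LinearMap.congr_fun this c

theorem boundary_cons (a : V) (l : List V) :
    boundary (Finsupp.single (a :: l) 1) =
      Finsupp.single l 1 + cone a (boundary (Finsupp.single l 1)) := by
  rw [← boundary_cone, cone_single]

/-- The chain map induced by a map of vertices. -/
noncomputable def map (f : V → W) : ListChain V →ₗ[ZMod 2] ListChain W :=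
  Finsupp.lmapDomain _ _ (List.map f)

@[simp] theorem map_single (f : V → W) (l : List V) (r : ZMod 2) :
    map f (Finsupp.single l r) = Finsupp.single (l.map f) r := by
  simp [map]

theorem map_cone (f : V → W) (a : V) (c : ListChain V) :
    map f (cone a c) = cone (f a) (map f c) := by
  have : map f ∘ₗ cone a = cone (f a) ∘ₗ map f := by
    ext1 l
    ext1
    simp
  exact LinearMap.congr_fun this c

theorem boundary_map (f : V → W) (c : ListChain V) :
    boundary (map f c) = map f (boundary c) := by
  have : boundary ∘ₗ map f = map f ∘ₗ boundary := by
    ext1 l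
    ext1
    induction l with
    | nil => simp
    | cons a l ih =>
      simp only [LinearMap.comp_apply, Finsupp.lsingle_apply, map_single, List.map_cons] at ih ⊢
      rw [boundary_cons, boundary_cons, map_add, map_cone, map_single, ih]
  exact LinearMap.congr_fun this c

theorem map_congr {f g : V → W} {A : Set (List V)} (h : ∀ l ∈ A, ∀ x ∈ l, f x = g x)
    {c : ListChain V} (hc : c ∈ Finsupp.supported (ZMod 2) (ZMod 2) A) : map f c = map g c :=
  Finsupp.eqOn_supported (fun l hl => by
    rw [map_single, map_single, List.map_congr_left (h l hl)]) hc

/-- The prism over an ordered simplex. -/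
noncomputable def prismAux (f g : V → W) : List V → ListChain W
  | [] => 0
  | a :: l => Finsupp.single (f a :: g a :: l.map g) 1 + cone (f a) (prismAux f g l)

/-- The prism operator, a chain homotopy between the chain maps induced by two maps. -/
noncomputable def prism (f g : V → W) : ListChain V →ₗ[ZMod 2] ListChain W :=
  Finsupp.linearCombination (ZMod 2) (prismAux f g)

theorem prism_cone (f g : V → W) (a : V) (c : ListChain V) :
    prism f g (cone a c) = cone (f a) (cone (g a) (map g c)) + cone (f a) (prism f g c) := by
  have : prism f g ∘ₗ cone a =
      cone (f a) ∘ₗ cone (g a) ∘ₗ map g + cone (f a) ∘ₗ prism f g := by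
    ext1 l
    ext1
    simp [prism, prismAux]
  exact LinearMap.congr_fun this c

theorem prism_cons (f g : V → W) (a : V) (l : List V) :
    prism f g (Finsupp.single (a :: l) 1) =
      cone (f a) (cone (g a) (map g (Finsupp.single l 1))) +
        cone (f a) (prism f g (Finsupp.single l 1)) := by
  rw [← prism_cone, cone_single]

/-- The classical prism identity, without signs mod 2. Prisms are built from cones, so it follows by
induction from `boundary_cone`. -/
theorem boundary_prism (f g : V → W) (c : ListChain V) :
    boundary (prism f g c) = map f c + map g c + prism f g (boundary c) := by
  have : boundary ∘ₗ prism f g = map f + map g + prism f g ∘ₗ boundary := by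
    ext1 l
    ext1
    induction l with
    | nil =>
      simp [prism, prismAux, ZModModule.add_self]
    | cons a l ih =>
      simp only [LinearMap.comp_apply, Finsupp.lsingle_apply, LinearMap.add_apply] at ih ⊢
      have hf : map f (Finsupp.single (a :: l) (1 : ZMod 2)) =
        cone (f a) (map f (Finsupp.single l 1)) := by simp
      have hg : map g (Finsupp.single (a :: l) (1 : ZMod 2)) =
        cone (g a) (map g (Finsupp.single l 1)) := by simp
      rw [prism_cons, boundary_cons, map_add, map_add, boundary_cone, boundary_cone, boundary_cone,
        ih, prism_cone, hf, hg, boundary_map]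
      simp only [map_add]
      -- The two sides differ only by `B` twice: once from deleting `g a` in the top list, once from
      -- the prism over `l`.
      set A := prism f g (Finsupp.single l 1)
      set B := cone (f a) (map g (Finsupp.single l (1 : ZMod 2)))
      set C := cone (f a) (cone (g a) (map g (boundary (Finsupp.single l (1 : ZMod 2)))))
      rw [← sub_eq_zero]
      have hB : B + B = 0 := ZModModule.add_self B
      rw [← hB]
      abel
  exact LinearMap.congr_fun this c

theorem prism_mem (f g : V → W) (l : List V) :
    prism f g (Finsupp.single l 1) ∈ Finsupp.supported (ZMod 2) (ZMod 2)
      {l' | l'.length = l.length + 1 ∧ ∀ x ∈ l', ∃ y ∈ l, x = f y ∨ x = g y} := by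
  induction l with
  | nil => simp [prism, prismAux]
  | cons a l ih =>
    rw [prism_cons]
    refine Submodule.add_mem _ ?_ (Finsupp.map_mem_of_mem_supported _ ?_ ih)
    · simp only [map_single, cone_single]
      refine Finsupp.single_mem_supported _ _ ⟨by simp, fun x hx => ?_⟩
      simp only [List.mem_cons, List.mem_map] at hx ⊢
      grind
    · rintro l' ⟨hl', h⟩
      rw [cone_single]
      refine Finsupp.single_mem_supported _ _ ⟨by simp [hl'], fun x hx => ?_⟩
      simp only [List.mem_cons] at hx ⊢
      grind

/-- A cycle bounds if it can be deformed in small steps to a constant one; the filling consists of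
the lists swept out by the steps. -/
theorem exists_boundary_eq_map (h : ℕ → V → W) (N : ℕ) (w : W) (hN : ∀ x, h N x = w)
    {z : ListChain V} (hz : boundary z = 0) (A : Set (List V))
    (hA : z ∈ Finsupp.supported (ZMod 2) (ZMod 2) A) (B : Set (List W))
    (hB : ∀ l ∈ A, ∀ k < N, ∀ l' : List W, l'.length = l.length + 1 →
      (∀ x ∈ l', ∃ y ∈ l, x = h k y ∨ x = h (k + 1) y) → l' ∈ B)
    (hw : ∀ l ∈ A, List.replicate (l.length + 1) w ∈ B) :
    ∃ c ∈ Finsupp.supported (ZMod 2) (ZMod 2) B, boundary c = map (h 0) z := by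
  -- The prisms telescope to `map (h 0) z + map (h N) z`; the cone with apex `w` fills the remaining
  -- constant cycle.
  refine ⟨∑ k ∈ Finset.range N, prism (h k) (h (k + 1)) z + cone w (map (h N) z),
    Submodule.add_mem _ (Submodule.sum_mem _ fun k hk => ?_) ?_, ?_⟩
  · refine Finsupp.map_mem_of_mem_supported _ (fun l hl => ?_) hA
    refine Finsupp.supported_mono ?_ (prism_mem _ _ l)
    rintro l' ⟨h1, h2⟩
    exact hB l hl k (Finset.mem_range.1 hk) l' h1 h2
  · refine Finsupp.map_mem_of_mem_supported (cone w ∘ₗ map (h N)) (fun l hl => ?_) hA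
    have : l.map (h N) = List.replicate l.length w := by
      rw [← List.map_const']
      exact List.map_congr_left fun x _ => hN x
    rw [LinearMap.comp_apply, map_single, cone_single, this]
    exact Finsupp.single_mem_supported _ _ (hw l hl)
  · have key : ∀ n, ∑ k ∈ Finset.range n, boundary (prism (h k) (h (k + 1)) z) =
        map (h 0) z + map (h n) z := by
      intro n
      induction n with
      | zero => simp [ZModModule.add_self]
      | succ n ih =>
        rw [Finset.sum_range_succ, ih, boundary_prism, hz, map_zero, add_zero, add_add_add_comm,
          ← add_assoc, add_assoc (map (h 0) z), ← add_assoc, add_assoc (map (h 0) z),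
          ZModModule.add_self, add_zero]
    rw [map_add, map_sum, key, boundary_cone, boundary_map, hz, map_zero, map_zero, add_zero,
      add_assoc, ZModModule.add_self, add_zero]

end ListChain

/-! ### Unordered chains and the passage from ordered to unordered simplices. -/

namespace SetChain

variable {V W : Type*} [DecidableEq V]

/-- The boundary operator, which deletes the elements of a finite set one at a time. -/
noncomputable def boundary : SetChain V →ₗ[ZMod 2] SetChain V :=
  Finsupp.linearCombination (ZMod 2) fun F => ∑ x ∈ F, Finsupp.single (F.erase x) 1

theorem boundary_single (F : Finset V) :
    boundary (Finsupp.single F 1) = ∑ x ∈ F, Finsupp.single (F.erase x) 1 := by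
  simp [boundary]

/-- The cone operator, which sends `F` to `insert a F` and to zero if `a ∈ F`. -/
noncomputable def cone (a : V) : SetChain V →ₗ[ZMod 2] SetChain V :=
  Finsupp.linearCombination (ZMod 2) fun F => if a ∈ F then 0 else Finsupp.single (insert a F) 1

theorem cone_single (a : V) (F : Finset V) :
    cone a (Finsupp.single F 1) = if a ∈ F then 0 else Finsupp.single (insert a F) 1 := by
  simp [cone]

/-- If `a ∈ F` the cone vanishes, and only the face `F.erase a` survives coning; it gives back `F`,
which cancels mod 2. -/
theorem boundary_cone (a : V) (c : SetChain V) :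
    boundary (cone a c) = c + cone a (boundary c) := by
  have : boundary ∘ₗ cone a = LinearMap.id + cone a ∘ₗ boundary := by
    ext1 F
    ext1
    simp only [LinearMap.comp_apply, Finsupp.lsingle_apply, LinearMap.add_apply, LinearMap.id_apply,
      cone_single, boundary_single, map_sum]
    split_ifs with h
    · rw [map_zero, Finset.sum_eq_single_of_mem a h]
      · simp [Finset.insert_erase h, ZModModule.add_self]
      · intro b _ hb
        simp [h, hb.symm]
    · rw [boundary_single, Finset.sum_insert h, Finset.erase_insert h]
      congr 1
      refine Finset.sum_congr rfl fun x hx => ?_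
      have hax : a ≠ x := fun h' => h (h' ▸ hx)
      rw [if_neg (by simp [h]), Finset.erase_insert_of_ne hax]
  exact LinearMap.congr_fun this c

theorem boundary_boundary_single (F : Finset V) :
    boundary (boundary (Finsupp.single F 1)) = 0 := by
  induction F using Finset.induction_on with
  | empty => simp [boundary]
  | insert a F ha ih =>
    have h : Finsupp.single (insert a F) (1 : ZMod 2) = cone a (Finsupp.single F 1) := by
      rw [cone_single, if_neg ha]
    rw [h, boundary_cone, map_add, boundary_cone, ih, map_zero, add_zero, ZModModule.add_self]

/-- The set underlying an ordered simplex, as a chain: degenerate simplices are sent to zero. -/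
noncomputable def ofListAux : List V → SetChain V
  | [] => Finsupp.single ∅ 1
  | a :: l => cone a (ofListAux l)

/-- The chain map that forgets the order. -/
noncomputable def ofList : ListChain V →ₗ[ZMod 2] SetChain V :=
  Finsupp.linearCombination (ZMod 2) ofListAux

@[simp] theorem ofList_nil : ofList (Finsupp.single ([] : List V) 1) = Finsupp.single ∅ 1 := by
  simp [ofList, ofListAux]

theorem ofList_cone (a : V) (c : ListChain V) :
    ofList (ListChain.cone a c) = cone a (ofList c) := by
  have : ofList ∘ₗ ListChain.cone a = cone a ∘ₗ ofList := by
    ext1 l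
    ext1
    simp [ofList, ofListAux]
  exact LinearMap.congr_fun this c

theorem boundary_ofList (c : ListChain V) :
    boundary (ofList c) = ofList (ListChain.boundary c) := by
  have : boundary ∘ₗ ofList = ofList ∘ₗ ListChain.boundary (V := V) := by
    ext1 l
    ext1
    induction l with
    | nil => simp [boundary]
    | cons a l ih =>
      simp only [LinearMap.comp_apply, Finsupp.lsingle_apply] at ih ⊢
      rw [ListChain.boundary_cons, map_add, ofList_cone, ← ih, ← ListChain.cone_single,
        ofList_cone, boundary_cone]
  exact LinearMap.congr_fun this c

theorem ofList_mem (l : List V) :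
    ofList (Finsupp.single l 1) ∈ Finsupp.supported (ZMod 2) (ZMod 2)
      {F : Finset V | F.card = l.length ∧ ∀ x ∈ F, x ∈ l} := by
  induction l with
  | nil =>
    rw [ofList_nil]
    exact Finsupp.single_mem_supported _ _ (by simp)
  | cons a l ih =>
    rw [← ListChain.cone_single, ofList_cone]
    refine Finsupp.map_mem_of_mem_supported _ ?_ ih
    rintro F ⟨h1, h2⟩
    rw [cone_single]
    split_ifs with h
    · exact Submodule.zero_mem _
    · refine Finsupp.single_mem_supported _ _ ⟨by simp [h, h1], ?_⟩
      simp only [Finset.mem_insert, List.mem_cons]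
      grind

/-- A degree preserving augmented chain map on a simplicial complex that sends every simplex to
a combination of its faces is the identity. -/
theorem eq_single_of_carried {X : Set (Finset V)}
    (hX : ∀ F ∈ X, ∀ x ∈ F, F.erase x ∈ X) (ψ : Finset V → SetChain V)
    (h0 : ψ ∅ = Finsupp.single ∅ 1)
    (hsupp : ∀ F ∈ X, ψ F ∈ Finsupp.supported (ZMod 2) (ZMod 2)
      {G : Finset V | G.card = F.card ∧ G ⊆ F})
    (hbd : ∀ F ∈ X, boundary (ψ F) = ∑ x ∈ F, ψ (F.erase x)) :
    ∀ F ∈ X, ψ F = Finsupp.single F 1 := by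
  intro F
  induction hn : F.card generalizing F with
  | zero => rw [Finset.card_eq_zero.1 hn]; exact fun _ => h0
  | succ n ih =>
    intro hF
    have hset : {G : Finset V | G.card = F.card ∧ G ⊆ F} = {F} := by
      ext G
      simp only [Set.mem_ofPred_eq, Set.mem_singleton_iff]
      exact ⟨fun h => Finset.eq_of_subset_of_card_le h.2 h.1.ge, fun h => by simp [h]⟩
    have h1 := hsupp F hF
    rw [hset, Finsupp.mem_supported] at h1
    obtain ⟨r, hr⟩ := Finsupp.support_subset_singleton'.1 (by exact_mod_cast h1)
    have h2 := hbd F hF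
    rw [Finset.sum_congr rfl fun x hx =>
      ih (F.erase x) (by rw [Finset.card_erase_of_mem hx, hn]; rfl) (hX F hF x hx)] at h2
    rw [hr]
    obtain ⟨x, hx⟩ : F.Nonempty := Finset.card_pos.1 (by omega)
    have hr01 : r = 0 ∨ r = 1 := by
      clear * -
      revert r; decide
    rcases hr01 with rfl | rfl
    -- If `r = 0`, the boundary of `ψ F` vanishes, yet by induction it is the sum of the distinct
    -- facets of `F`.
    · exfalso
      rw [hr, Finsupp.single_zero, map_zero] at h2
      have h3 := DFunLike.congr_fun h2 (F.erase x)
      rw [Finsupp.finsetSum_apply, Finset.sum_eq_single_of_mem x hx] at h3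
      · simp at h3
      · intro y hy hyx
        exact Finsupp.single_eq_of_ne fun h => hyx (F.erase_injOn hy hx h.symm)
    · rfl

end SetChain

/-! ### Fine ordered chains in convex sets -/

section Fine

variable {V : Type*} [SeminormedAddCommGroup V]

/-- The lists of length `n` of points of `Y` with pairwise distances less than `ε`. -/
def fineLists (ε : ℝ) (Y : Set V) (n : ℕ) : Set (List V) :=
  {l | l.length = n ∧ (∀ x ∈ l, x ∈ Y) ∧ ∀ x ∈ l, ∀ y ∈ l, dist x y < ε}

theorem fineLists_mono (ε : ℝ) {Y Y' : Set V} (h : Y ⊆ Y') (n : ℕ) :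
    fineLists ε Y n ⊆ fineLists ε Y' n :=
  fun _ hl => ⟨hl.1, fun x hx => h (hl.2.1 x hx), hl.2.2⟩

variable [NormedSpace ℝ V]

/-- The complex of fine ordered chains in a nonempty convex set is acyclic. -/
theorem exists_boundary_eq_of_convex {ε : ℝ} (hε : 0 < ε) {Y : Set V} (hY : Convex ℝ Y)
    (hne : Y.Nonempty) {n : ℕ} {z : ListChain V}
    (hz : z ∈ Finsupp.supported (ZMod 2) (ZMod 2) (fineLists ε Y n))
    (hbd : ListChain.boundary z = 0) :
    ∃ c ∈ Finsupp.supported (ZMod 2) (ZMod 2) (fineLists ε Y (n + 1)),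
      ListChain.boundary c = z := by
  obtain ⟨w, hw⟩ := hne
  -- The straight-line contraction to `w` in `N` steps moves `y` by `dist y w / N` per step.
  -- Finitely many strict inequalities leave room for this.
  have hev : ∀ᶠ N : ℕ in Filter.atTop, ∀ l ∈ z.support, ∀ x ∈ l, ∀ y ∈ l,
      dist x y + dist y w / N < ε := by
    rw [Filter.eventually_all_finset]
    intro l hl
    refine (Filter.eventually_all_finite (List.finite_toSet l)).2 fun x hx => ?_
    refine (Filter.eventually_all_finite (List.finite_toSet l)).2 fun y hy => ?_
    have h1 : Filter.Tendsto (fun N : ℕ => dist x y + dist y w / N) Filter.atTop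
        (𝓝 (dist x y + 0)) :=
      tendsto_const_nhds.add (tendsto_const_div_atTop_nhds_zero_nat _)
    refine h1.eventually_lt_const ?_
    rw [add_zero]
    exact (((Finsupp.mem_supported _ _).1 hz) hl).2.2 x hx y hy
  obtain ⟨N, hN, hN0⟩ := (hev.and (Filter.eventually_gt_atTop 0)).exists
  have hN0' : (0 : ℝ) < N := by exact_mod_cast hN0
  let h : ℕ → V → V := fun k x => AffineMap.lineMap x w ((k : ℝ) / N)
  have h0 : h 0 = id := by
    funext x
    simp [h]
  have hstep : ∀ k, ∀ x, dist (h k x) (h (k + 1) x) = dist x w / N := by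
    intro k x
    simp only [h]
    rw [dist_lineMap_lineMap, Real.dist_eq, Nat.cast_add, Nat.cast_one,
      show (k : ℝ) / N - (k + 1) / N = - (1 / N) by ring, abs_neg, abs_of_pos (by positivity)]
    ring
  have hle : ∀ k ≤ N, ∀ x y, dist (h k x) (h k y) ≤ dist x y := by
    intro k hk x y
    have hk' : (k : ℝ) / N ≤ 1 := by
      rw [div_le_one hN0']
      exact_mod_cast hk
    have hk0 : 0 ≤ (k : ℝ) / N := by positivity
    simp only [h, AffineMap.lineMap_apply_module]
    rw [dist_add_right, dist_smul₀, Real.norm_of_nonneg (by linarith)]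
    exact mul_le_of_le_one_left dist_nonneg (by linarith)
  have hmem : ∀ k ≤ N, ∀ x ∈ Y, h k x ∈ Y := by
    intro k hk x hx
    refine hY.lineMap_mem hx hw ⟨by positivity, ?_⟩
    rw [div_le_one hN0']
    exact_mod_cast hk
  have hA : z ∈ Finsupp.supported (ZMod 2) (ZMod 2) (z.support : Set (List V)) :=
    (Finsupp.mem_supported _ _).2 subset_rfl
  have hzl := (Finsupp.mem_supported _ _).1 hz
  obtain ⟨c, hc, hcz⟩ := ListChain.exists_boundary_eq_map h N w
    (fun x => by simp [h, div_self hN0'.ne']) hbd _ hA (fineLists ε Y (n + 1)) (by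
      intro l hl k hk l' hlen hl'
      have hl := Finset.mem_coe.1 hl
      refine ⟨by rw [hlen, (hzl hl).1], fun x hx => ?_, fun x hx y hy => ?_⟩
      · obtain ⟨y, hy, rfl | rfl⟩ := hl' x hx
        · exact hmem k hk.le y ((hzl hl).2.1 y hy)
        · exact hmem (k + 1) hk y ((hzl hl).2.1 y hy)
      · obtain ⟨x, hx, hx'⟩ := hl' x hx
        obtain ⟨y, hy, hy'⟩ := hl' y hy
        have e1 : dist x w / N ≥ 0 := by positivity
        have e2 : dist y w / N ≥ 0 := by positivity
        have e3 := hN l hl x hx y hy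
        have e4 := hN l hl y hy x hx
        rw [dist_comm y x] at e4
        rcases hx' with rfl | rfl <;> rcases hy' with rfl | rfl
        · linarith [hle k hk.le x y]
        · linarith [hle k hk.le x y, dist_triangle (h k x) (h k y) (h (k + 1) y), hstep k y]
        · linarith [hle k hk.le x y, dist_triangle (h (k + 1) x) (h k x) (h k y), hstep k x,
            dist_comm (h (k + 1) x) (h k x)]
        · linarith [hle (k + 1) hk x y])
    (by
      intro l hl
      refine ⟨by rw [List.length_replicate, (hzl hl).1], fun x hx => ?_, fun x hx y hy => ?_⟩
      · rwa [List.eq_of_mem_replicate hx]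
      · rwa [List.eq_of_mem_replicate hx, List.eq_of_mem_replicate hy, dist_self])
  refine ⟨c, hc, ?_⟩
  rw [hcz, h0]
  simp [ListChain.map]

variable [DecidableEq V]

open Classical in
/-- A fine ordered chain subdividing the simplex with the given vertices. -/
noncomputable def subdivision (ε : ℝ) (s : Finset V) : ListChain V :=
  if s = ∅ then Finsupp.single [] 1
  else
    if h : ∃ c ∈ Finsupp.supported (ZMod 2) (ZMod 2)
        (fineLists ε (convexHull ℝ (s : Set V)) s.card),
        ListChain.boundary c = ∑ x ∈ s.attach, subdivision ε (s.erase x) then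
      h.choose
    -- Never reached for `0 < ε`, by `subdivision_spec`.
    else 0
termination_by s.card
decreasing_by exact Finset.card_erase_lt_of_mem x.2

theorem subdivision_empty (ε : ℝ) : subdivision ε (∅ : Finset V) = Finsupp.single [] 1 := by
  rw [subdivision, if_pos rfl]

/-- Acyclic carriers: the subdivided facets form a cycle of fine lists in the convex hull, where
every such cycle bounds. -/
theorem subdivision_spec {ε : ℝ} (hε : 0 < ε) (s : Finset V) :
    subdivision ε s ∈ Finsupp.supported (ZMod 2) (ZMod 2)
        (fineLists ε (convexHull ℝ (s : Set V)) s.card) ∧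
      ListChain.boundary (subdivision ε s) = ∑ x ∈ s, subdivision ε (s.erase x) := by
  induction hn : s.card generalizing s with
  | zero =>
    rw [Finset.card_eq_zero.1 hn, subdivision_empty]
    exact ⟨Finsupp.single_mem_supported _ _ ⟨rfl, by simp, by simp⟩, by simp⟩
  | succ n ih =>
    have hs : s.Nonempty := Finset.card_pos.1 (by omega)
    have hc : ∀ x ∈ s, (s.erase x).card = n := fun x hx => by
      rw [Finset.card_erase_of_mem hx, hn]; rfl
    have h : ∃ c ∈ Finsupp.supported (ZMod 2) (ZMod 2)
        (fineLists ε (convexHull ℝ (s : Set V)) s.card),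
        ListChain.boundary c = ∑ x ∈ s.attach, subdivision ε (s.erase x) := by
      rw [Finset.sum_attach s fun x => subdivision ε (s.erase x), hn]
      refine exists_boundary_eq_of_convex hε (convex_convexHull ℝ _)
        ((convexHull_nonempty_iff (𝕜 := ℝ)).2 (by exact_mod_cast hs))
        (Submodule.sum_mem _ fun x hx => ?_) ?_
      · exact Finsupp.supported_mono
          (fineLists_mono ε (convexHull_mono (by exact_mod_cast Finset.erase_subset _ _)) n)
          (ih (s.erase x) (hc x hx)).1
      · rw [map_sum, Finset.sum_congr rfl fun x hx => (ih (s.erase x) (hc x hx)).2]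
        -- The cycle condition is the image of `∂∂ = 0` under the linear extension of `subdivision
        -- ε`.
        have := congrArg (Finsupp.linearCombination (ZMod 2) (subdivision ε))
          (SetChain.boundary_boundary_single s)
        simpa [SetChain.boundary_single] using this
    rw [← hn, ← Finset.sum_attach s fun x => subdivision ε (s.erase x)]
    have hdef : subdivision ε s = h.choose := by
      rw [subdivision, if_neg hs.ne_empty, dif_pos h]
    rw [hdef]
    exact h.choose_spec

end Fine

/-! ### Lifts of simplices to a covering space -/

section Lift

variable {V : Type*} [NormedAddCommGroup V] [NormedSpace ℝ V]
variable {K : Geometry.SimplicialComplex ℝ V} {E : Type*}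

/-- `ℓ` restricts to a continuous lift of the simplex spanned by `s` along `p`. -/
structure IsSimplexLift [TopologicalSpace E] (p : E → K.space) (s : Finset V) (ℓ : V → E) :
    Prop where
  continuousOn : ContinuousOn ℓ (convexHull ℝ (s : Set V))
  apply_eq : ∀ x ∈ convexHull ℝ (s : Set V), (p (ℓ x) : V) = x

namespace IsSimplexLift

variable [TopologicalSpace E] {p : E → K.space} {s s' : Finset V} {ℓ ℓ' : V → E}

theorem mono (h : IsSimplexLift p s ℓ) (hs : s' ⊆ s) : IsSimplexLift p s' ℓ :=
  have hsub : convexHull ℝ (s' : Set V) ⊆ convexHull ℝ (s : Set V) :=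
    convexHull_mono (by exact_mod_cast hs)
  ⟨h.continuousOn.mono hsub, fun x hx => h.apply_eq x (hsub hx)⟩

theorem injOn (h : IsSimplexLift p s ℓ) : Set.InjOn ℓ (convexHull ℝ (s : Set V)) :=
  fun x hx y hy hxy => by rw [← h.apply_eq x hx, ← h.apply_eq y hy, hxy]

theorem smul {Γ : Type*} [Group Γ] [MulAction Γ E] (hp : IsQuotientCoveringMap p Γ)
    (h : IsSimplexLift p s ℓ) (γ : Γ) : IsSimplexLift p s fun x => γ • ℓ x :=
  have := hp.toContinuousConstSMul
  ⟨h.continuousOn.const_smul γ, fun x hx => by rw [hp.map_smul]; exact h.apply_eq x hx⟩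

/-- Uniqueness of lifts on the intersection of the two hulls, which is convex and hence connected.
-/
theorem eq_of_eq (hp : IsCoveringMap p) (h : IsSimplexLift p s ℓ) (h' : IsSimplexLift p s' ℓ')
    {x : V} (hx : x ∈ convexHull ℝ (s : Set V)) (hx' : x ∈ convexHull ℝ (s' : Set V))
    (hxx : ℓ x = ℓ' x) {y : V} (hy : y ∈ convexHull ℝ (s : Set V))
    (hy' : y ∈ convexHull ℝ (s' : Set V)) : ℓ y = ℓ' y :=
  hp.eqOn_of_comp_eqOn
    ((convex_convexHull ℝ (s : Set V)).inter (convex_convexHull ℝ (s' : Set V))).isPreconnected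
    (h.continuousOn.mono Set.inter_subset_left) (h'.continuousOn.mono Set.inter_subset_right)
    (fun z hz => Subtype.ext ((h.apply_eq z hz.1).trans (h'.apply_eq z hz.2).symm))
    ⟨hx, hx'⟩ hxx ⟨hy, hy'⟩

end IsSimplexLift

/-- Lift the straight-line homotopy from the constant map at `p e` to the inclusion of the simplex,
and take its end. -/
theorem exists_isSimplexLift [TopologicalSpace E] {p : E → K.space} (hp : IsCoveringMap p)
    {s : Finset V} (hs : s ∈ K.faces) (e : E) (he : (p e : V) ∈ convexHull ℝ (s : Set V)) :
    ∃ ℓ, IsSimplexLift p s ℓ ∧ ℓ (p e) = e := by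
  classical
  have hconv := convex_convexHull ℝ (s : Set V)
  have hmem : ∀ q : unitInterval × convexHull ℝ (s : Set V),
      AffineMap.lineMap (p e : V) (q.2 : V) (q.1 : ℝ) ∈ convexHull ℝ (s : Set V) :=
    fun q => hconv.lineMap_mem he q.2.2 q.1.2
  let H : C(unitInterval × convexHull ℝ (s : Set V), K.space) :=
    ⟨fun q => ⟨AffineMap.lineMap (p e : V) (q.2 : V) (q.1 : ℝ),
      K.convexHull_subset_space hs (hmem q)⟩, by
      simp only [AffineMap.lineMap_apply_module]
      fun_prop⟩
  have H0 : ∀ a, H (0, a) = p (ContinuousMap.const _ e a) := fun a => Subtype.ext (by simp [H])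
  let L := hp.liftHomotopy H (ContinuousMap.const _ e) H0
  have hL : ∀ q, p (L q) = H q := fun q => congrFun (hp.liftHomotopy_lifts H _ H0) q
  refine ⟨fun x => if hx : x ∈ convexHull ℝ (s : Set V) then L (1, ⟨x, hx⟩) else e, ⟨?_, ?_⟩, ?_⟩
  · rw [continuousOn_iff_continuous_domRestrict]
    have : Continuous fun x : convexHull ℝ (s : Set V) => L (1, x) := by fun_prop
    convert! this using 2 with x
    simp
  · intro x hx
    rw [dif_pos hx, hL]
    simp [H]
  · refine (dif_pos he).trans ?_
    -- The homotopy fixes the point `p e`, so its lift is constant there.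
    have hc : ∀ t : unitInterval, L (t, ⟨p e, he⟩) = L (0, ⟨p e, he⟩) := fun t =>
      hp.const_of_comp (g := fun t : unitInterval => L (t, ⟨(p e : V), he⟩)) (by fun_prop)
        (fun t t' => by rw [hL, hL]; exact Subtype.ext (by simp [H])) t 0
    rw [hc]
    exact hp.liftHomotopy_zero H _ H0 _

/-! ### Vertex maps -/

/-- A choice of nearby vertices: a vertex `v y` of the carrier of `y` for every `y`, such that `v`
maps a neighbourhood of `y` to vertices of the carrier of `y`. -/
theorem Geometry.SimplicialComplex.exists_vertex_map (hK : K.faces.Finite) :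
    ∃ v : V → V, ∀ y ∈ K.space, ∃ U ∈ 𝓝 y, ∀ z ∈ U, z ∈ K.space → ∀ s ∈ K.faces,
      y ∈ convexHull ℝ (s : Set V) → v z ∈ s := by
  classical
  have hclosed : ∀ s : Finset V, IsClosed (convexHull ℝ (s : Set V)) := fun s =>
    (s.finite_toSet.isCompact_convexHull ℝ).isClosed
  let T : Finset V := hK.toFinset.biUnion id
  -- On the space of `K` this is the open star of `v`.
  let u : T → Set V := fun v => ⋂ s ∈ {s ∈ K.faces | (v : V) ∉ s}, (convexHull ℝ (s : Set V))ᶜ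
  have huo : ∀ v, IsOpen (u v) := fun v =>
    (hK.subset (Set.sep_subset _ _)).isOpen_biInter fun s _ => (hclosed s).isOpen_compl
  have hspace : IsClosed K.space := hK.isClosed_biUnion fun s _ => hclosed s
  have hcover : K.space ⊆ ⋃ v, u v := by
    intro y hy
    -- A smallest face containing `y` lies in every face containing `y`, so `y` is in the star of
    -- each of its vertices.
    obtain ⟨s, hs, hmin⟩ := Set.exists_min_image {s ∈ K.faces | y ∈ convexHull ℝ (s : Set V)}
      Finset.card (hK.subset (Set.sep_subset _ _)) (by
        obtain ⟨s, hs, hys⟩ := K.mem_space_iff.1 hy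
        exact ⟨s, hs, hys⟩)
    obtain ⟨v, hv⟩ := K.nonempty_of_mem_faces hs.1
    refine Set.mem_iUnion.2 ⟨⟨v, Finset.mem_biUnion.2 ⟨s, by simpa using hs.1, hv⟩⟩, ?_⟩
    refine Set.mem_iInter₂.2 fun t ht hyt => ht.2 ?_
    have hyst := K.inter_subset_convexHull hs.1 ht.1 ⟨hs.2, hyt⟩
    rw [← Finset.coe_inter] at hyst
    have hne : (s ∩ t).Nonempty := by
      have := (convexHull_nonempty_iff (𝕜 := ℝ)).1 ⟨y, hyst⟩
      exact_mod_cast this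
    have hle := hmin (s ∩ t) ⟨K.down_closed hs.1 Finset.inter_subset_left hne, hyst⟩
    have := Finset.eq_of_subset_of_card_le Finset.inter_subset_left hle
    rw [← this] at hv
    exact (Finset.mem_inter.1 hv).2
  -- Shrinking the stars to closed sets makes the choice stable: a point near `y` lies only in those
  -- `F w` that contain `y`.
  obtain ⟨F, hF, hFc, hFu⟩ := exists_subset_iUnion_closed_subset hspace huo
    (fun _ _ => Set.toFinite _) hcover
  have hchoice : ∀ y, ∃ v : V, y ∈ K.space → ∃ h : v ∈ T, y ∈ F ⟨v, h⟩ := by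
    intro y
    by_cases hy : y ∈ K.space
    · obtain ⟨v, hv⟩ := Set.mem_iUnion.1 (hF hy)
      exact ⟨v, fun _ => ⟨v.2, hv⟩⟩
    · exact ⟨0, fun h => absurd h hy⟩
  choose v hv using hchoice
  refine ⟨v, fun y hy => ⟨⋂ w ∈ {w | y ∉ F w}, (F w)ᶜ, ?_, ?_⟩⟩
  · refine IsOpen.mem_nhds ((Set.toFinite _).isOpen_biInter fun w _ => (hFc w).isOpen_compl) ?_
    exact Set.mem_iInter₂.2 fun w hw => hw
  · intro z hz hzK s hs hys
    obtain ⟨hT, hzF⟩ := hv z hzK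
    have hyF : y ∈ F ⟨v z, hT⟩ := by
      by_contra h
      exact Set.mem_iInter₂.1 hz ⟨v z, hT⟩ h hzF
    by_contra h
    exact Set.mem_iInter₂.1 (hFu _ hyF) s ⟨hs, h⟩ hys

/-- A lift of a vertex map to a covering space. -/
theorem exists_lifted_vertex_map [TopologicalSpace E] {p : E → K.space} (hK : K.faces.Finite)
    (hp : IsCoveringMap p) :
    ∃ v : E → E,
      (∀ s ∈ K.faces, ∀ ℓ, IsSimplexLift p s ℓ → ∀ y ∈ convexHull ℝ (s : Set V),
        ∃ x ∈ s, v (ℓ y) = ℓ x) ∧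
      ∀ e, ∃ U ∈ 𝓝 e, ∃ s ∈ K.faces, ∃ ℓ, IsSimplexLift p s ℓ ∧ ∀ e' ∈ U, ∃ x ∈ s, v e' = ℓ x := by
  obtain ⟨v₀, hv₀⟩ := Geometry.SimplicialComplex.exists_vertex_map hK
  have hv₀s : ∀ s ∈ K.faces, ∀ y ∈ convexHull ℝ (s : Set V), v₀ y ∈ s := by
    intro s hs y hy
    have hyK := K.convexHull_subset_space hs hy
    obtain ⟨U, hU, h⟩ := hv₀ y hyK
    exact h y (mem_of_mem_nhds hU) hyK s hs hy
  have hsub : ∀ s : Finset V, ∀ x ∈ s, x ∈ convexHull ℝ (s : Set V) := fun s x hx =>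
    subset_convexHull ℝ _ hx
  have hlift : ∀ e, ∃ s ∈ K.faces, ∃ ℓ, IsSimplexLift p s ℓ ∧
      (p e : V) ∈ convexHull ℝ (s : Set V) ∧ ℓ (p e) = e := by
    intro e
    obtain ⟨s, hs, hes⟩ := K.mem_space_iff.1 (p e).2
    obtain ⟨ℓ, hℓ, hℓe⟩ := exists_isSimplexLift hp hs e hes
    exact ⟨s, hs, ℓ, hℓ, hes, hℓe⟩
  choose S hS L hL hmem hLe using hlift
  -- The lift of `v₀` does not depend on the lifted simplex chosen through the point.
  have hva : ∀ s ∈ K.faces, ∀ ℓ, IsSimplexLift p s ℓ → ∀ y ∈ convexHull ℝ (s : Set V),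
      L (ℓ y) (v₀ y) = ℓ (v₀ y) := by
    intro s hs ℓ hℓ y hy
    have hy' : (p (ℓ y) : V) = y := hℓ.apply_eq y hy
    have h1 := hmem (ℓ y)
    have h2 := hLe (ℓ y)
    rw [hy'] at h1 h2
    exact (hL (ℓ y)).eq_of_eq hp hℓ h1 hy h2 (hsub _ _ (hv₀s _ (hS _) y h1))
      (hsub _ _ (hv₀s s hs y hy))
  refine ⟨fun e => L e (v₀ (p e)), fun s hs ℓ hℓ y hy => ⟨v₀ y, hv₀s s hs y hy, ?_⟩, fun e => ?_⟩
  · simp only [hℓ.apply_eq y hy]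
    exact hva s hs ℓ hℓ y hy
  obtain ⟨U₀, hU₀, hU₀v⟩ := hv₀ (p e) (p e).2
  obtain ⟨φ, heφ, hφ⟩ := hp.isLocalHomeomorph e
  have hpe : p e ∈ φ.target := by rw [hφ]; exact φ.map_source heφ
  obtain ⟨δ, hδ, hball⟩ := Metric.isOpen_iff.1 φ.open_target _ hpe
  -- Near `p e`, every face that is met contains `p e`.
  let W : Set V := ⋂ t ∈ {t ∈ K.faces | (p e : V) ∉ convexHull ℝ (t : Set V)},
    (convexHull ℝ (t : Set V))ᶜ
  have hW : W ∈ 𝓝 (p e : V) := by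
    refine IsOpen.mem_nhds ((hK.subset (Set.sep_subset _ _)).isOpen_biInter fun t _ =>
      (t.finite_toSet.isCompact_convexHull ℝ).isClosed.isOpen_compl) ?_
    exact Set.mem_iInter₂.2 fun t ht => ht.2
  have hcont : Continuous fun e => (p e : V) := continuous_subtype_val.comp hp.continuous
  refine ⟨φ.source ∩ (fun e => (p e : V)) ⁻¹' (U₀ ∩ W ∩ Metric.ball (p e : V) δ),
    Filter.inter_mem (φ.open_source.mem_nhds heφ) (hcont.continuousAt.preimage_mem_nhds
      (Filter.inter_mem (Filter.inter_mem hU₀ hW) (Metric.ball_mem_nhds _ hδ))),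
    S e, hS e, L e, hL e, ?_⟩
  rintro e' ⟨he's, ⟨he'U, he'W⟩, he'b⟩
  have hv : v₀ (p e') ∈ S e := hU₀v _ he'U (p e').2 _ (hS e) (hmem e)
  refine ⟨v₀ (p e'), hv, ?_⟩
  have het : (p e : V) ∈ convexHull ℝ (S e' : Set V) := by
    by_contra h
    exact Set.mem_iInter₂.1 he'W (S e') ⟨hS e', h⟩ (hmem e')
  -- On the part of the simplex in the ball, `L e'` and the local inverse of `p` are lifts agreeing
  -- at `p e'`, so `L e'` passes through `e`.
  have hagree : L e' (p e) = e := by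
    let C : Set V := convexHull ℝ (S e' : Set V) ∩ Metric.ball (p e : V) δ
    have hC : IsPreconnected C :=
      ((convex_convexHull ℝ _).inter (convex_ball _ _)).isPreconnected
    have hCK : ∀ x ∈ C, x ∈ K.space := fun x hx => K.convexHull_subset_space (hS e') hx.1
    have hCt : ∀ x (hx : x ∈ C), (⟨x, hCK x hx⟩ : K.space) ∈ φ.target := fun x hx => hball hx.2
    classical
    let σ : V → E := fun x => if hx : x ∈ K.space then φ.symm ⟨x, hx⟩ else e
    have hσp : ∀ a : E, σ (p a) = φ.symm (p a) := fun a => dif_pos (p a).2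
    have hσ : ContinuousOn σ C := by
      rw [continuousOn_iff_continuous_domRestrict]
      have : Continuous fun x : C => φ.symm ⟨x, hCK x x.2⟩ :=
        φ.continuousOn_symm.comp_continuous (by fun_prop) fun x => hCt x x.2
      convert! this using 2 with x
      exact dif_pos (hCK x x.2)
    have := hp.eqOn_of_comp_eqOn hC ((hL e').continuousOn.mono Set.inter_subset_left) hσ
      (fun x hx => by
        have hx1 : p (L e' x) = ⟨x, hCK x hx⟩ := Subtype.ext ((hL e').apply_eq x hx.1)
        have hx2 : σ x = φ.symm ⟨x, hCK x hx⟩ := dif_pos (hCK x hx)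
        simp only [Function.comp_apply, hx1, hx2]
        rw [hφ, φ.right_inv (hCt x hx)])
      (a := (p e' : V)) ⟨hmem e', he'b⟩ (by
        rw [hLe e', hσp, hφ, φ.left_inv he's])
    rw [this ⟨het, Metric.mem_ball_self hδ⟩, hσp, hφ, φ.left_inv heφ]
  exact (hL e').eq_of_eq hp (hL e) het (hmem e) (hagree.trans (hLe e).symm)
    (hsub _ _ (hv₀s _ (hS e') _ (hmem e'))) (hsub _ _ hv)

end Lift

/-! ### Acyclicity of the triangulation of a contractible covering space -/

section Acyclic

variable {V : Type*} [NormedAddCommGroup V] [NormedSpace ℝ V]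
variable {K : Geometry.SimplicialComplex ℝ V} {E : Type*} [TopologicalSpace E] [DecidableEq E]

/-- The abstract simplicial complex of the lifted triangulation of a covering space, including
the empty simplex. -/
def liftedFaces (p : E → K.space) : Set (Finset E) :=
  {F | ∃ s : Finset V, (s = ∅ ∨ s ∈ K.faces) ∧ ∃ ℓ, IsSimplexLift p s ℓ ∧ F = s.image ℓ}

variable {p : E → K.space}

theorem liftedFaces_mono {F G : Finset E} (hF : F ∈ liftedFaces p) (hG : G ⊆ F) :
    G ∈ liftedFaces p := by
  obtain ⟨s, hs, ℓ, hℓ, rfl⟩ := hF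
  obtain ⟨t, ht, rfl⟩ := Finset.subset_image_iff.1 hG
  have hts : t ⊆ s := by exact_mod_cast ht
  refine ⟨t, ?_, ℓ, hℓ.mono hts, rfl⟩
  rcases hs with rfl | hs
  · exact Or.inl (Finset.subset_empty.1 hts)
  · rcases t.eq_empty_or_nonempty with h | h
    · exact Or.inl h
    · exact Or.inr (K.down_closed hs hts h)

/-- A simplex of the covering space determines its projection and its lift. -/
theorem IsSimplexLift.eq_of_image_eq {s s' : Finset V} {ℓ ℓ' : V → E} (hp : IsCoveringMap p)
    (hℓ : IsSimplexLift p s ℓ) (hℓ' : IsSimplexLift p s' ℓ') (h : s.image ℓ = s'.image ℓ') :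
    s = s' ∧ ∀ y ∈ convexHull ℝ (s : Set V), ℓ y = ℓ' y := by
  have hsub : ∀ s : Finset V, ∀ x ∈ s, x ∈ convexHull ℝ (s : Set V) := fun s x hx =>
    subset_convexHull ℝ _ hx
  have key : ∀ {s s' : Finset V} {ℓ ℓ' : V → E}, IsSimplexLift p s ℓ → IsSimplexLift p s' ℓ' →
      s.image ℓ = s'.image ℓ' → ∀ x ∈ s, x ∈ s' ∧ ℓ x = ℓ' x := by
    intro s s' ℓ ℓ' hℓ hℓ' h x hx
    obtain ⟨x', hx', hxx⟩ := Finset.mem_image.1 (h ▸ Finset.mem_image_of_mem ℓ hx)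
    have : x' = x := by
      rw [← hℓ'.apply_eq x' (hsub _ _ hx'), hxx, hℓ.apply_eq x (hsub _ _ hx)]
    subst this
    exact ⟨hx', hxx.symm⟩
  have hss : s = s' := Finset.Subset.antisymm (fun x hx => (key hℓ hℓ' h x hx).1)
    fun x hx => (key hℓ' hℓ h.symm x hx).1
  subst hss
  refine ⟨rfl, fun y hy => ?_⟩
  obtain ⟨x, hx⟩ := (convexHull_nonempty_iff (𝕜 := ℝ)).1 ⟨y, hy⟩
  exact hℓ.eq_of_eq hp hℓ' (hsub _ _ hx) (hsub _ _ hx) (key hℓ hℓ' h x hx).2 hy hy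

variable [DecidableEq V]

open Classical in
/-- The fine ordered chain in the covering space subdividing a lifted simplex. -/
noncomputable def liftedSubdivision (p : E → K.space) (ε : ℝ) (F : Finset E) : ListChain E :=
  if h : F ∈ liftedFaces p then
    ListChain.map h.choose_spec.2.choose (subdivision ε h.choose)
  else 0

/-- The choices in the definition are harmless, since a lifted simplex determines its base simplex
and its lift on the hull. -/
theorem liftedSubdivision_image (hp : IsCoveringMap p) {ε : ℝ} (hε : 0 < ε) {s : Finset V}
    (hs : s = ∅ ∨ s ∈ K.faces) {ℓ : V → E} (hℓ : IsSimplexLift p s ℓ) :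
    liftedSubdivision p ε (s.image ℓ) = ListChain.map ℓ (subdivision ε s) := by
  have h : s.image ℓ ∈ liftedFaces p := ⟨s, hs, ℓ, hℓ, rfl⟩
  rw [liftedSubdivision, dif_pos h]
  obtain ⟨h1, h2⟩ := hℓ.eq_of_image_eq hp h.choose_spec.2.choose_spec.1
    h.choose_spec.2.choose_spec.2
  refine (congrArg _ (congrArg (subdivision ε) h1.symm)).trans ?_
  exact ListChain.map_congr (fun l hl x hx => (h2 x (hl.2.1 x hx)).symm)
    (subdivision_spec hε s).1

theorem boundary_liftedSubdivision (hp : IsCoveringMap p) {ε : ℝ} (hε : 0 < ε) {F : Finset E}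
    (hF : F ∈ liftedFaces p) :
    ListChain.boundary (liftedSubdivision p ε F) =
      ∑ x ∈ F, liftedSubdivision p ε (F.erase x) := by
  obtain ⟨s, hs, ℓ, hℓ, rfl⟩ := hF
  have hinj : Set.InjOn ℓ s := hℓ.injOn.mono (subset_convexHull ℝ _)
  rw [liftedSubdivision_image hp hε hs hℓ, ListChain.boundary_map, (subdivision_spec hε s).2,
    map_sum, Finset.sum_image hinj]
  refine Finset.sum_congr rfl fun x hx => ?_
  have herase : (s.image ℓ).erase (ℓ x) = (s.erase x).image ℓ := by
    ext e
    simp only [Finset.mem_erase, Finset.mem_image]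
    constructor
    · rintro ⟨h1, y, hy, rfl⟩
      exact ⟨y, ⟨fun h => h1 (h ▸ rfl), hy⟩, rfl⟩
    · rintro ⟨y, ⟨h1, hy⟩, rfl⟩
      exact ⟨fun h => h1 (hinj hy hx h), y, hy, rfl⟩
  rw [herase, liftedSubdivision_image hp hε _ (hℓ.mono (Finset.erase_subset _ _))]
  rcases hs with rfl | hs
  · simp at hx
  · rcases (s.erase x).eq_empty_or_nonempty with h | h
    · exact Or.inl h
    · exact Or.inr (K.down_closed hs (Finset.erase_subset _ _) h)

/-- The lifted triangulation of a contractible covering space is acyclic. -/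
theorem exists_boundary_eq_of_contractible [ContractibleSpace E] (hK : K.faces.Finite)
    (hp : IsCoveringMap p) {z : SetChain E}
    (hz : z ∈ Finsupp.supported (ZMod 2) (ZMod 2) (liftedFaces p))
    (hbd : SetChain.boundary z = 0) :
    ∃ c ∈ Finsupp.supported (ZMod 2) (ZMod 2) (liftedFaces p), SetChain.boundary c = z := by
  obtain ⟨v, hv, hvloc⟩ := exists_lifted_vertex_map hK hp
  obtain ⟨w, ⟨H⟩⟩ := id_nullhomotopic E
  have hsz : ∀ F : z.support, ∃ s : Finset V, (s = ∅ ∨ s ∈ K.faces) ∧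
      ∃ ℓ, IsSimplexLift p s ℓ ∧ (F : Finset E) = s.image ℓ := fun F =>
    ((Finsupp.mem_supported _ _).1 hz) F.2
  choose S hS L hL hFS using hsz
  -- A Lebesgue number for the contraction on the finitely many simplices of `z`: over nearby times
  -- and points, `v` takes values in the vertices of one lifted simplex.
  have hleb : ∀ᶠ ε : ℝ in 𝓝[>] 0, ∀ F : z.support, ∀ t : unitInterval,
      ∀ y ∈ convexHull ℝ (S F : Set V), ∃ s ∈ K.faces, ∃ ℓ, IsSimplexLift p s ℓ ∧
        ∀ t' : unitInterval, ∀ y' ∈ convexHull ℝ (S F : Set V), dist t' t < ε → dist y' y < ε →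
          ∃ x ∈ s, v (H (t', L F y')) = ℓ x := by
    refine Filter.eventually_all.2 fun F => ?_
    choose U hU T hT M hM hUM using hvloc
    have hcpt : IsCompact ((Set.univ : Set unitInterval) ×ˢ convexHull ℝ (S F : Set V)) :=
      isCompact_univ.prod ((S F).finite_toSet.isCompact_convexHull ℝ)
    have hG : ContinuousOn (fun q : unitInterval × V => H (q.1, L F q.2))
        (Set.univ ×ˢ convexHull ℝ (S F : Set V)) :=
      H.continuous.comp_continuousOn (continuousOn_fst.prodMk
        ((hL F).continuousOn.comp continuousOn_snd fun q hq => hq.2))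
    obtain ⟨δ, hδ, hball⟩ := Metric.uniformity_basis_dist.lebesgue_number_lemma_nhdsWithin
      (U := fun q => (fun q : unitInterval × V => H (q.1, L F q.2)) ⁻¹' U (H (q.1, L F q.2))) hcpt
      (fun q hq => (hG q hq).preimage_mem_nhdsWithin (hU _))
    filter_upwards [Ioo_mem_nhdsGT hδ] with ε hε t y hy
    obtain ⟨q, hq⟩ := hball (t, y) ⟨trivial, hy⟩
    refine ⟨_, hT _, _, hM _, fun t' y' hy' ht hyy =>
      hUM (H (q.1, L F q.2)) _ (@hq (t', y') ⟨?_, trivial, hy'⟩)⟩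
    change dist (t, y) (t', y') < δ
    rw [dist_comm, Prod.dist_eq]
    exact max_lt (ht.trans hε.2) (hyy.trans hε.2)
  obtain ⟨ε, hεH, hε⟩ := (hleb.and self_mem_nhdsWithin).exists
  replace hε : 0 < ε := hε
  have hX : ∀ F ∈ liftedFaces p, ∀ x ∈ F, F.erase x ∈ liftedFaces p := fun F hF x _ =>
    liftedFaces_mono hF (Finset.erase_subset _ _)
  have hid : ∀ F ∈ liftedFaces p,
      SetChain.ofList (ListChain.map v (liftedSubdivision p ε F)) = Finsupp.single F 1 := by
    refine SetChain.eq_single_of_carried hX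
      (fun F => SetChain.ofList (ListChain.map v (liftedSubdivision p ε F))) ?_ ?_ ?_
    · have hlift : IsSimplexLift p ∅ (fun _ => w) := ⟨by simp, by simp⟩
      have := liftedSubdivision_image hp hε (Or.inl rfl) hlift
      rw [Finset.image_empty, subdivision_empty, ListChain.map_single] at this
      simp only [this, ListChain.map_single, List.map_nil, SetChain.ofList_nil]
    · rintro F ⟨s, hs, ℓ, hℓ, rfl⟩
      rw [liftedSubdivision_image hp hε hs hℓ]
      refine Finsupp.map_mem_of_mem_supported
        (SetChain.ofList ∘ₗ ListChain.map v ∘ₗ ListChain.map ℓ) (fun l hl => ?_)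
        (subdivision_spec hε s).1
      simp only [LinearMap.comp_apply, ListChain.map_single]
      refine Finsupp.supported_mono ?_ (SetChain.ofList_mem _)
      rintro G ⟨hG, hGl⟩
      refine ⟨?_, fun e he => ?_⟩
      · rw [hG, List.length_map, List.length_map, hl.1,
          Finset.card_image_of_injOn (hℓ.injOn.mono (subset_convexHull ℝ _))]
      · have := hGl e he
        simp only [List.mem_map, exists_exists_and_eq_and] at this
        obtain ⟨y, hy, rfl⟩ := this
        have hy' := hl.2.1 y hy
        rcases hs with rfl | hs
        · simp at hy'
        · obtain ⟨x, hx, hxe⟩ := hv s hs ℓ hℓ y hy'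
          exact hxe ▸ Finset.mem_image_of_mem ℓ hx
    · intro F hF
      rw [SetChain.boundary_ofList, ListChain.boundary_map, boundary_liftedSubdivision hp hε hF,
        map_sum, map_sum]
  let Θ : SetChain E →ₗ[ZMod 2] ListChain E :=
    Finsupp.linearCombination (ZMod 2) (liftedSubdivision p ε)
  have hΘs : ∀ F, Θ (Finsupp.single F 1) = liftedSubdivision p ε F := fun F => by simp [Θ]
  have hΘz : ListChain.boundary (Θ z) = 0 := by
    have h1 : (ListChain.boundary ∘ₗ Θ) z = (Θ ∘ₗ SetChain.boundary) z :=
      Finsupp.eqOn_supported (fun F hF => by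
        simp only [LinearMap.comp_apply, SetChain.boundary_single, map_sum, hΘs]
        exact boundary_liftedSubdivision hp hε hF) hz
    simpa [hbd] using h1
  have hvΘ : SetChain.ofList (ListChain.map v (Θ z)) = z :=
    Finsupp.eqOn_supported (f := SetChain.ofList ∘ₗ ListChain.map v ∘ₗ Θ) (g := LinearMap.id)
      (fun F hF => by
        simp only [LinearMap.comp_apply, hΘs, LinearMap.id_apply]
        exact hid F hF) hz
  obtain ⟨N, hN⟩ := exists_nat_one_div_lt hε
  -- Time is cut into `N + 1` steps of length `1 / (N + 1) < ε`, clamped to the unit interval.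
  let τ : ℕ → unitInterval := fun k => Set.projIcc (0 : ℝ) 1 zero_le_one (k / (N + 1 : ℕ))
  have hτ : ∀ k, dist (τ (k + 1)) (τ k) < ε := by
    intro k
    refine lt_of_le_of_lt (((LipschitzWith.projIcc (zero_le_one (α := ℝ))).dist_le_mul _ _)) ?_
    rw [NNReal.coe_one, one_mul, Real.dist_eq, ← sub_div]
    push_cast
    rw [add_sub_cancel_left, abs_of_pos (by positivity)]
    exact hN
  obtain ⟨c, hc, hcz⟩ := ListChain.exists_boundary_eq_map (fun k e => H (τ k, e)) (N + 1) w
    (fun e => by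
      have : τ (N + 1) = 1 := by
        simp only [τ]
        rw [div_self (by positivity)]
        exact Set.projIcc_right _
      simp [this]) hΘz
    {l | ∃ F : z.support, ∃ l' ∈ fineLists ε (convexHull ℝ (S F : Set V)) (S F).card,
      l = l'.map (L F)}
    (by
      have hz' : z ∈ Finsupp.supported (ZMod 2) (ZMod 2) (z.support : Set (Finset E)) :=
        (Finsupp.mem_supported _ _).2 subset_rfl
      refine Finsupp.map_mem_of_mem_supported Θ (fun F hF => ?_) hz'
      have hF' := hFS ⟨F, hF⟩
      simp only at hF'
      rw [hΘs, hF', liftedSubdivision_image hp hε (hS _) (hL _)]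
      refine Finsupp.map_mem_of_mem_supported _ (fun l hl => ?_) (subdivision_spec hε _).1
      rw [ListChain.map_single]
      exact Finsupp.single_mem_supported _ _ ⟨⟨F, hF⟩, l, hl, rfl⟩)
    -- These are the lists that `v` turns into faces of the lifted triangulation.
    {l | ∃ s ∈ K.faces, ∃ ℓ, IsSimplexLift p s ℓ ∧ ∀ e ∈ l, ∃ x ∈ s, v e = ℓ x}
    (by
      rintro _ ⟨F, l, hl, rfl⟩ k hk l' hlen hl'
      obtain ⟨e₀, he₀⟩ := List.exists_mem_of_length_pos (l := l') (by omega)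
      obtain ⟨_, hy₀', -⟩ := hl' e₀ he₀
      obtain ⟨y₀, hy₀, rfl⟩ := List.mem_map.1 hy₀'
      obtain ⟨s, hs, ℓ, hℓ, h⟩ := hεH F (τ k) y₀ (hl.2.1 y₀ hy₀)
      refine ⟨s, hs, ℓ, hℓ, fun e he => ?_⟩
      obtain ⟨_, hy', hey⟩ := hl' e he
      obtain ⟨y, hy, rfl⟩ := List.mem_map.1 hy'
      rcases hey with rfl | rfl
      · exact h _ y (hl.2.1 y hy) (by rwa [dist_self]) (hl.2.2 y hy y₀ hy₀)
      · exact h _ y (hl.2.1 y hy) (hτ k) (hl.2.2 y hy y₀ hy₀))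
    (by
      intro l _
      obtain ⟨U, hU, s, hs, ℓ, hℓ, h⟩ := hvloc w
      refine ⟨s, hs, ℓ, hℓ, fun e he => ?_⟩
      rw [List.eq_of_mem_replicate he]
      exact h w (mem_of_mem_nhds hU))
  refine ⟨SetChain.ofList (ListChain.map v c), ?_, ?_⟩
  · refine Finsupp.map_mem_of_mem_supported (SetChain.ofList ∘ₗ ListChain.map v) ?_ hc
    rintro l ⟨s, hs, ℓ, hℓ, hl⟩
    rw [LinearMap.comp_apply, ListChain.map_single]
    refine Finsupp.supported_mono ?_ (SetChain.ofList_mem _)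
    rintro G ⟨-, hG⟩
    refine liftedFaces_mono ⟨s, Or.inr hs, ℓ, hℓ, rfl⟩ fun e he => ?_
    obtain ⟨e', he', rfl⟩ := List.mem_map.1 (hG e he)
    obtain ⟨x, hx, hxe⟩ := hl e' he'
    exact hxe ▸ Finset.mem_image_of_mem ℓ hx
  · rw [SetChain.boundary_ofList, ListChain.boundary_map, hcz]
    have h0 : (fun e => H (τ 0, e)) = id := by
      have : τ 0 = 0 := by
        simp only [τ, Nat.cast_zero, zero_div]
        exact Set.projIcc_left _
      funext e
      simp [this]
    rw [h0]
    have hmap : ListChain.map (id : E → E) (Θ z) = Θ z := by simp [ListChain.map]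
    rw [hmap, hvΘ]

end Acyclic

/-! ### Coboundaries -/

/-- The mod 2 coboundary of a function on finite sets. -/
def coboundary {E : Type*} [DecidableEq E] (f : Finset E → ZMod 2) (F : Finset E) : ZMod 2 :=
  ∑ x ∈ F, f (F.erase x)

section Coboundary

variable {E : Type*} [DecidableEq E]

theorem coboundary_add (f g : Finset E → ZMod 2) :
    coboundary (f + g) = coboundary f + coboundary g :=
  funext fun _ => Finset.sum_add_distrib

theorem coboundary_congr {f g : Finset E → ZMod 2} {F : Finset E}
    (h : ∀ x ∈ F, f (F.erase x) = g (F.erase x)) : coboundary f F = coboundary g F :=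
  Finset.sum_congr rfl h

theorem linearCombination_boundary (f : Finset E → ZMod 2) (c : SetChain E) :
    Finsupp.linearCombination (ZMod 2) f (SetChain.boundary c) =
      Finsupp.linearCombination (ZMod 2) (coboundary f) c := by
  have : Finsupp.linearCombination (ZMod 2) f ∘ₗ SetChain.boundary =
      Finsupp.linearCombination (ZMod 2) (coboundary f) := by
    ext F
    simp [SetChain.boundary_single, coboundary]
  exact LinearMap.congr_fun this c

theorem coboundary_coboundary (f : Finset E → ZMod 2) (F : Finset E) :
    coboundary (coboundary f) F = 0 := by
  have h := linearCombination_boundary f (SetChain.boundary (Finsupp.single F 1))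
  rw [SetChain.boundary_boundary_single, map_zero, linearCombination_boundary] at h
  simpa using h.symm

/-- Cochains on an acyclic complex are exact. -/
theorem exists_coboundary_eq {X : Set (Finset E)}
    (hX : ∀ z ∈ Finsupp.supported (ZMod 2) (ZMod 2) X, SetChain.boundary z = 0 →
      ∃ c ∈ Finsupp.supported (ZMod 2) (ZMod 2) X, SetChain.boundary c = z)
    {f : Finset E → ZMod 2} (hf : ∀ F ∈ X, coboundary f F = 0) :
    ∃ g, ∀ F ∈ X, coboundary g F = f F := by
  let Z := Finsupp.supported (ZMod 2) (ZMod 2) X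
  let d : Z →ₗ[ZMod 2] SetChain E := SetChain.boundary.domRestrict Z
  let f' : Module.Dual (ZMod 2) Z := (Finsupp.linearCombination (ZMod 2) f).domRestrict Z
  -- A cocycle kills every cycle because cycles bound. Over a field, a functional vanishing on `ker
  -- d` factors through `d`, giving `g`.
  have hf' : f' ∈ (LinearMap.ker d).dualAnnihilator := by
    rw [Submodule.mem_dualAnnihilator]
    rintro ⟨z, hz⟩ hzd
    obtain ⟨c, hc, rfl⟩ := hX z hz hzd
    change Finsupp.linearCombination (ZMod 2) f (SetChain.boundary c) = 0
    rw [linearCombination_boundary]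
    exact Finsupp.eqOn_supported (g := 0) (fun F hF => by simpa using hf F hF) hc
  rw [← LinearMap.range_dualMap_eq_dualAnnihilator_ker] at hf'
  obtain ⟨g, hg⟩ := hf'
  refine ⟨fun F => g (Finsupp.single F 1), fun F hF => ?_⟩
  have h := LinearMap.congr_fun hg ⟨Finsupp.single F 1, Finsupp.single_mem_supported _ _ hF⟩
  change g (SetChain.boundary (Finsupp.single F 1)) =
    Finsupp.linearCombination (ZMod 2) f (Finsupp.single F 1) at h
  rw [SetChain.boundary_single, map_sum] at h
  simpa [coboundary] using h

theorem coboundary_image {f f' : Finset E → ZMod 2} {u : E → E} (hu : Function.Injective u)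
    {F : Finset E} (h : ∀ x ∈ F, f (F.erase x) = f' ((F.erase x).image u)) :
    coboundary f F = coboundary f' (F.image u) := by
  rw [coboundary, coboundary, Finset.sum_image hu.injOn]
  exact Finset.sum_congr rfl fun x hx => by rw [h x hx, Finset.image_erase hu]

end Coboundary

/-! ### Linear subshifts of simplicial cochains -/

/-- Each output coordinate depends on finitely many input coordinates, so it is locally constant. -/
theorem BernoulliShift.continuous_of_forall_finite {Γ S T : Type*}
    {f : BernoulliShift Γ S → BernoulliShift Γ T}
    (h : ∀ γ, ∃ J : Set Γ, J.Finite ∧ ∀ τ τ' : BernoulliShift Γ S,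
      (∀ j ∈ J, τ j = τ' j) → f τ γ = f τ' γ) : Continuous f := by
  let _ : TopologicalSpace S := ⊥
  have : DiscreteTopology S := ⟨rfl⟩
  let _ : TopologicalSpace T := ⊥
  have : DiscreteTopology T := ⟨rfl⟩
  refine continuous_pi (A := fun _ : Γ => T) fun γ => ?_
  obtain ⟨J, hJ, hf⟩ := h γ
  refine IsLocallyConstant.continuous ((IsLocallyConstant.iff_exists_open _).2 fun τ => ?_)
  refine ⟨{τ' | ∀ j ∈ J, τ' j = τ j}, ?_, fun _ _ => rfl, fun τ' hτ' => hf _ _ hτ'⟩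
  have h1 : {τ' : Γ → S | ∀ j ∈ J, τ' j = τ j} = ⋂ j ∈ J, (fun τ' : Γ → S => τ' j) ⁻¹' {τ j} := by
    ext τ'
    simp
  have h2 : IsOpen {τ' : Γ → S | ∀ j ∈ J, τ' j = τ j} := by
    rw [h1]
    exact hJ.isOpen_biInter fun j _ => (isOpen_discrete _).preimage (continuous_apply j)
  exact h2

/-- The addition formula with the kernel replaced by any linear subshift that agrees with it. -/
theorem AdditiveEntropy.h_add_of_ker {Γ : Type*} [Monoid Γ] (H : AdditiveEntropy Γ)
    {S₁ S₂ : Type} [AddCommGroup S₁] [Finite S₁] [AddCommGroup S₂] [Finite S₂]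
    {φ₁ φ₃ : LinearSubshift Γ S₁} {φ₂ : LinearSubshift Γ S₂} (T : φ₁.Points →+ φ₂.Points)
    (hT : Continuous T) (hequiv : ∀ (γ : Γ) (τ : φ₁.Points), T (γ • τ) = γ • T τ)
    (hsurj : Function.Surjective T) (hle : φ₃.toAddSubgroup ≤ φ₁.toAddSubgroup)
    (hker : ∀ τ : φ₁.Points, T τ = 0 ↔ (τ : BernoulliShift Γ S₁) ∈ φ₃.toAddSubgroup) :
    H.h φ₃ + H.h φ₂ = H.h φ₁ := by
  have h : LinearSubshift.ker T hT hequiv = φ₃ := by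
    have h' : (LinearSubshift.ker T hT hequiv).toAddSubgroup = φ₃.toAddSubgroup := by
      ext τ
      constructor
      · rintro ⟨σ, hσ, rfl⟩
        exact (hker σ).1 hσ
      · intro hτ
        exact ⟨⟨τ, hle hτ⟩, (hker _).2 hτ, rfl⟩
    generalize LinearSubshift.ker T hT hequiv = φ at h'
    cases φ
    cases φ₃
    congr
  rw [← h]
  exact H.h_add φ₁ φ₂ T hT hequiv hsurj

/-- The kernel of a continuous equivariant endomorphism of Bernoulli shifts. -/
def LinearSubshift.ofKer {Γ S T : Type*} [Monoid Γ] [AddCommGroup S] [AddCommGroup T]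
    (D : BernoulliShift Γ S →+ BernoulliShift Γ T) (hD : Continuous D)
    (hequiv : ∀ (γ : Γ) τ, D (γ • τ) = γ • D τ) : LinearSubshift Γ S where
  toAddSubgroup := D.ker
  isClosed := isClosed_singleton.preimage hD
  smul_mem γ τ hτ := by
    rw [AddMonoidHom.mem_ker] at hτ ⊢
    rw [hequiv, hτ, BernoulliShift.smul_zero]

/-- An indexing by `ι × Γ` of the nonempty simplices of a free `Γ`-complex `X` with finitely many
orbits, `ι` being the set of orbits. -/
structure OrbitLabelling (Γ ι : Type*) {E : Type*} [Group Γ] [MulAction Γ E] [DecidableEq E]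
    (X : Set (Finset E)) where
  /-- the simplex with given label -/
  simplex : ι → Γ → Finset E
  /-- the number of vertices of the simplices in an orbit -/
  card : ι → ℕ
  card_simplex : ∀ s γ, (simplex s γ).card = card s
  card_pos : ∀ s, 0 < card s
  mem : ∀ s γ, simplex s γ ∈ X
  injective : Function.Injective fun q : ι × Γ => simplex q.1 q.2
  exists_eq : ∀ F ∈ X, F.Nonempty → ∃ s γ, F = simplex s γ
  simplex_mul : ∀ s γ δ, simplex s (γ * δ) = (simplex s γ).image (δ⁻¹ • ·)

/-! ### Cochains on a free complex as points of Bernoulli shifts. -/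

namespace OrbitLabelling

variable {Γ ι E : Type*} [Group Γ] [MulAction Γ E] [DecidableEq E] {X : Set (Finset E)}

/-- The orbits of simplices whose number of vertices has parity `b`. -/
abbrev Orbits (L : OrbitLabelling Γ ι X) (b : ℕ) : Type _ := {s : ι // L.card s % 2 = b}

/-- The alphabet for cochains of parity `b`. -/
abbrev Alphabet (L : OrbitLabelling Γ ι X) (b : ℕ) : Type _ := L.Orbits b → ZMod 2

variable (L : OrbitLabelling Γ ι X) {b c : ℕ}

/-- A cochain of given parity as a function on all finite sets. -/
noncomputable def extend (τ : BernoulliShift Γ (L.Alphabet b)) : Finset E → ZMod 2 :=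
  Function.extend (fun q : ι × Γ => L.simplex q.1 q.2)
    (fun q => if h : L.card q.1 % 2 = b then τ q.2 ⟨q.1, h⟩ else 0) 0

theorem extend_simplex (τ : BernoulliShift Γ (L.Alphabet b)) (s : ι) (γ : Γ) :
    L.extend τ (L.simplex s γ) = if h : L.card s % 2 = b then τ γ ⟨s, h⟩ else 0 :=
  L.injective.extend_apply _ _ (s, γ)

/-- This drops the augmentation: coboundaries of extended cochains vanish on vertices, which is why
constants survive as cocycles. -/
theorem extend_empty (τ : BernoulliShift Γ (L.Alphabet b)) : L.extend τ ∅ = 0 := by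
  refine Function.extend_apply' _ _ _ ?_
  rintro ⟨⟨s, γ⟩, h⟩
  have h1 := L.card_simplex s γ
  have h2 := L.card_pos s
  simp only at h
  rw [h, Finset.card_empty] at h1
  omega

theorem extend_add (τ τ' : BernoulliShift Γ (L.Alphabet b)) :
    L.extend (τ + τ') = L.extend τ + L.extend τ' := by
  rw [extend, extend, extend, ← Function.extend_add]
  congr 1
  · funext q
    by_cases h : L.card q.1 % 2 = b
    · simp only [Pi.add_apply, dif_pos h]
      rfl
    · simp [h]

theorem extend_eq_zero (τ : BernoulliShift Γ (L.Alphabet b)) {F : Finset E} (hF : F ∈ X)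
    (hb : F.card % 2 ≠ b) : L.extend τ F = 0 := by
  rcases F.eq_empty_or_nonempty with rfl | hne
  · exact L.extend_empty τ
  · obtain ⟨s, γ, rfl⟩ := L.exists_eq F hF hne
    rw [L.card_simplex] at hb
    rw [L.extend_simplex, dif_neg hb]

/-- The shift translates labels on the right, which by `simplex_mul` moves simplices by the inverse.
-/
theorem extend_smul (γ : Γ) (τ : BernoulliShift Γ (L.Alphabet b)) {F : Finset E} (hF : F ∈ X) :
    L.extend (γ • τ) F = L.extend τ (F.image (γ⁻¹ • ·)) := by
  rcases F.eq_empty_or_nonempty with rfl | hne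
  · rw [Finset.image_empty, extend_empty, extend_empty]
  · obtain ⟨s, δ, rfl⟩ := L.exists_eq F hF hne
    rw [← L.simplex_mul, extend_simplex, extend_simplex]
    rfl

/-- The restriction of a function to the simplices of given parity. -/
def restrict (b : ℕ) (f : Finset E → ZMod 2) : BernoulliShift Γ (L.Alphabet b) :=
  fun γ s => f (L.simplex s γ)

theorem extend_restrict {f : Finset E → ZMod 2} (h0 : f ∅ = 0)
    (hf : ∀ F ∈ X, F.card % 2 ≠ b → f F = 0) {F : Finset E} (hF : F ∈ X) :
    L.extend (L.restrict b f) F = f F := by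
  rcases F.eq_empty_or_nonempty with rfl | hne
  · rw [extend_empty, h0]
  · obtain ⟨s, γ, rfl⟩ := L.exists_eq F hF hne
    rw [extend_simplex]
    split_ifs with h
    · rfl
    · exact (hf _ hF (by rwa [L.card_simplex])).symm

/-- The coboundary operator between cochains of given parities. -/
noncomputable def diff (b c : ℕ) :
    BernoulliShift Γ (L.Alphabet b) →+ BernoulliShift Γ (L.Alphabet c) :=
  AddMonoidHom.mk' (fun τ => L.restrict c (coboundary (L.extend τ))) fun τ τ' => by
    rw [extend_add, coboundary_add]
    rfl

theorem diff_apply (τ : BernoulliShift Γ (L.Alphabet b)) (γ : Γ) (s : L.Orbits c) :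
    L.diff b c τ γ s = coboundary (L.extend τ) (L.simplex s γ) := rfl

theorem continuous_diff [Finite ι] : Continuous (L.diff b c) := by
  refine BernoulliShift.continuous_of_forall_finite fun γ => ?_
  let 𝓕 : Set (Finset E) := ⋃ s : ι, (L.simplex s γ).erase '' (L.simplex s γ : Set E)
  have h𝓕 : 𝓕.Finite := Set.finite_iUnion fun s => (Finset.finite_toSet _).image _
  refine ⟨Prod.snd '' ((fun q : ι × Γ => L.simplex q.1 q.2) ⁻¹' 𝓕),
    (h𝓕.preimage L.injective.injOn).image _, fun τ τ' h => ?_⟩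
  funext s
  rw [diff_apply, diff_apply]
  refine coboundary_congr fun x hx => ?_
  by_cases hr : ∃ q : ι × Γ, L.simplex q.1 q.2 = (L.simplex s γ).erase x
  · obtain ⟨⟨t, δ⟩, hq⟩ := hr
    simp only at hq
    rw [← hq, extend_simplex, extend_simplex, h δ ⟨(t, δ), ?_, rfl⟩]
    exact Set.mem_iUnion.2 ⟨s, x, hx, hq.symm⟩
  · rw [extend, extend, Function.extend_apply' _ _ _ hr, Function.extend_apply' _ _ _ hr]

variable (hX : ∀ F ∈ X, ∀ x ∈ F, F.erase x ∈ X)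

include hX

theorem diff_smul (γ : Γ) (τ : BernoulliShift Γ (L.Alphabet b)) :
    L.diff b c (γ • τ) = γ • L.diff b c τ := by
  funext δ s
  rw [BernoulliShift.smul_apply, diff_apply, diff_apply, simplex_mul]
  exact coboundary_image (MulAction.injective _) fun x hx =>
    L.extend_smul γ τ (hX _ (L.mem _ _) x hx)

theorem coboundary_extend_eq_zero (τ : BernoulliShift Γ (L.Alphabet b)) {F : Finset E}
    (hF : F ∈ X) (hb : F.card % 2 = b) : coboundary (L.extend τ) F = 0 := by
  refine Finset.sum_eq_zero fun x hx => L.extend_eq_zero τ (hX F hF x hx) ?_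
  have := Finset.card_pos.2 ⟨x, hx⟩
  rw [Finset.card_erase_of_mem hx]
  omega

theorem extend_diff (hbc : b + c = 1) (τ : BernoulliShift Γ (L.Alphabet b)) {F : Finset E}
    (hF : F ∈ X) : L.extend (L.diff b c τ) F = coboundary (L.extend τ) F :=
  L.extend_restrict (by simp [coboundary])
    (fun F hF h => L.coboundary_extend_eq_zero hX τ hF (by omega)) hF

theorem diff_restrict {f : Finset E → ZMod 2} (h0 : f ∅ = 0)
    (hf : ∀ F ∈ X, F.card % 2 ≠ b → f F = 0) :
    L.diff b c (L.restrict b f) = L.restrict c (coboundary f) := by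
  funext γ s
  exact coboundary_congr fun x hx => L.extend_restrict h0 hf (hX _ (L.mem _ _) x hx)

theorem diff_diff (hbc : b + c = 1) (τ : BernoulliShift Γ (L.Alphabet b)) :
    L.diff c b (L.diff b c τ) = 0 := by
  funext γ s
  rw [diff_apply]
  refine (coboundary_congr fun x hx => L.extend_diff hX hbc τ (hX _ (L.mem _ _) x hx)).trans ?_
  exact coboundary_coboundary _ _

omit hX in
theorem diff_vertex (τ : BernoulliShift Γ (L.Alphabet b)) (γ : Γ) (s : L.Orbits c)
    (hs : L.card s = 1) : L.diff b c τ γ s = 0 := by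
  rw [diff_apply]
  refine Finset.sum_eq_zero fun x hx => ?_
  have h : (L.simplex s γ).erase x = ∅ := by
    rw [← Finset.card_eq_zero, Finset.card_erase_of_mem hx, L.card_simplex, hs]
  rw [h, extend_empty]

variable (hexact : ∀ f : Finset E → ZMod 2, (∀ F ∈ X, coboundary f F = 0) →
  ∃ g, ∀ F ∈ X, coboundary g F = f F)

include hexact

/-- Exactness of the cochain complex, up to the constants in degree zero. -/
theorem exists_diff_eq (hbc : b + c = 1) (τ : BernoulliShift Γ (L.Alphabet b))
    (hτ : L.diff b c τ = 0) :
    ∃ (σ : BernoulliShift Γ (L.Alphabet c)) (r : ZMod 2), ∀ γ (s : L.Orbits b),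
      τ γ s = if L.card s = 1 then r else L.diff c b σ γ s := by
  obtain ⟨g, hg⟩ := hexact (L.extend τ) fun F hF => by
    rw [← L.extend_diff hX hbc τ hF, hτ]
    rcases F.eq_empty_or_nonempty with rfl | hne
    · exact L.extend_empty _
    · obtain ⟨s, γ, rfl⟩ := L.exists_eq F hF hne
      rw [extend_simplex]
      split_ifs <;> rfl
  -- Restricting `g` forgets only its value on the empty simplex, which enters the coboundary at
  -- vertices alone.
  refine ⟨L.restrict c g, g ∅, fun γ s => ?_⟩
  have h1 : τ γ s = coboundary g (L.simplex s γ) := by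
    rw [hg _ (L.mem _ _), extend_simplex, dif_pos s.2]
  have hcard := L.card_simplex s γ
  rw [h1]
  split_ifs with hs
  · rw [hs, Finset.card_eq_one] at hcard
    obtain ⟨x, hx⟩ := hcard
    simp [coboundary, hx]
  · rw [diff_apply]
    refine coboundary_congr fun x hx => ?_
    have hF := hX _ (L.mem s γ) x hx
    have hc : ((L.simplex s γ).erase x).card = L.card s - 1 := by
      rw [Finset.card_erase_of_mem hx, hcard]
    have hpos := L.card_pos s
    obtain ⟨t, δ, ht⟩ := L.exists_eq _ hF (Finset.card_pos.1 (by omega))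
    have hb := s.2
    have ht' : L.card t % 2 = c := by
      rw [← L.card_simplex t δ, ← ht, hc]
      omega
    rw [ht, extend_simplex, dif_pos ht']
    rfl

end OrbitLabelling

/-! ### Cocycle subshifts and the entropy count. -/

namespace OrbitLabelling

variable {Γ ι E : Type*} [Group Γ] [MulAction Γ E] [DecidableEq E] {X : Set (Finset E)}

/-- The linear subshift of cocycles of parity `b`. -/
noncomputable def cocycles (L : OrbitLabelling Γ ι X) [Finite ι]
    (hX : ∀ F ∈ X, ∀ x ∈ F, F.erase x ∈ X) (b c : ℕ) : LinearSubshift Γ (L.Alphabet b) :=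
  LinearSubshift.ofKer (L.diff b c) L.continuous_diff (L.diff_smul hX)

/-- The linear subshift of cocycles that vanish on a given orbit. -/
noncomputable def reducedCocycles (L : OrbitLabelling Γ ι X) [Finite ι]
    (hX : ∀ F ∈ X, ∀ x ∈ F, F.erase x ∈ X) (b c : ℕ) (s₀ : L.Orbits b) :
    LinearSubshift Γ (L.Alphabet b) where
  toAddSubgroup := (L.cocycles hX b c).toAddSubgroup ⊓
    { carrier := {τ | ∀ γ, τ γ s₀ = 0}
      add_mem' := fun {τ τ'} h h' γ => by
        change τ γ s₀ + τ' γ s₀ = 0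
        rw [h, h', add_zero]
      zero_mem' := fun _ => rfl
      neg_mem' := fun {τ} h γ => by
        change -τ γ s₀ = 0
        rw [h, neg_zero] }
  isClosed := by
    refine (L.cocycles hX b c).isClosed.inter ?_
    let f : BernoulliShift Γ (L.Alphabet b) → BernoulliShift Γ (ZMod 2) := fun τ γ => τ γ s₀
    have hf : Continuous f := BernoulliShift.continuous_of_forall_finite fun γ =>
      ⟨{γ}, Set.finite_singleton γ, fun τ τ' h => congrFun (h γ rfl) s₀⟩
    have : {τ : BernoulliShift Γ (L.Alphabet b) | ∀ γ, τ γ s₀ = 0} = f ⁻¹' {0} := by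
      ext τ
      exact funext_iff.symm
    change IsClosed {τ : BernoulliShift Γ (L.Alphabet b) | ∀ γ, τ γ s₀ = 0}
    rw [this]
    exact isClosed_singleton.preimage hf
  smul_mem γ τ hτ := ⟨(L.cocycles hX b c).smul_mem γ hτ.1, fun δ => hτ.2 (δ * γ)⟩

/-- The linear subshift of constant functions. -/
def _root_.LinearSubshift.const (Γ S : Type*) [Monoid Γ] [AddCommGroup S] :
    LinearSubshift Γ S where
  toAddSubgroup :=
    { carrier := {τ | ∀ γ, τ γ = τ 1}
      add_mem' := fun {τ τ'} h h' γ => by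
        change τ γ + τ' γ = τ 1 + τ' 1
        rw [h, h']
      zero_mem' := fun _ => rfl
      neg_mem' := fun {τ} h γ => by
        change -τ γ = -τ 1
        rw [h] }
  isClosed := by
    let f : BernoulliShift Γ S → BernoulliShift Γ S := fun τ γ => τ γ - τ 1
    have hf : Continuous f := BernoulliShift.continuous_of_forall_finite fun γ =>
      ⟨{γ, 1}, Set.toFinite _, fun τ τ' h => by
        simp only [f]
        rw [h γ (by simp), h 1 (by simp)]⟩
    have : {τ : BernoulliShift Γ S | ∀ γ, τ γ = τ 1} = f ⁻¹' {0} := by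
      ext τ
      exact (forall_congr' fun γ => sub_eq_zero.symm).trans funext_iff.symm
    change IsClosed {τ : BernoulliShift Γ S | ∀ γ, τ γ = τ 1}
    rw [this]
    exact isClosed_singleton.preimage hf
  smul_mem γ τ hτ δ := (hτ (δ * γ)).trans (hτ (1 * γ)).symm

theorem _root_.LinearSubshift.finite_const (Γ S : Type*) [Monoid Γ] [AddCommGroup S] [Finite S] :
    Finite (LinearSubshift.const Γ S).Points := by
  refine Finite.of_injective (fun τ => (τ : BernoulliShift Γ S) 1) fun τ τ' h => ?_
  exact Subtype.ext (funext fun γ => (τ.2 γ).trans (h.trans (τ'.2 γ).symm))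

/-- A symbolically entropy additive group acts on a finite dimensional acyclic complex, freely on
nonempty simplices and with finitely many orbits, only if there are as many orbits of odd as of
even dimensional simplices. -/
theorem natCard_orbits_eq {ι : Type} (L : OrbitLabelling Γ ι X) [Finite ι]
    (hX : ∀ F ∈ X, ∀ x ∈ F, F.erase x ∈ X)
    (hexact : ∀ f : Finset E → ZMod 2, (∀ F ∈ X, coboundary f F = 0) →
      ∃ g, ∀ F ∈ X, coboundary g F = f F)
    (s₀ : ι) (hs₀ : L.card s₀ = 1) (H : AdditiveEntropy Γ) :
    Nat.card (L.Orbits 1) = Nat.card (L.Orbits 0) := by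
  let v : L.Orbits 1 := ⟨s₀, by rw [hs₀]⟩
  have hAB := L.continuous_diff (b := 1) (c := 0)
  have hBA := L.continuous_diff (b := 0) (c := 1)
  -- Parity `1` is an odd number of vertices, so even dimension. Cocycles of odd dimension are all
  -- coboundaries.
  have h1 : H.h (L.cocycles hX 1 0) + H.h (L.cocycles hX 0 1) =
      H.h (LinearSubshift.full Γ (L.Alphabet 1)) := by
    refine H.h_add_of_ker (φ₁ := LinearSubshift.full Γ (L.Alphabet 1))
      (AddMonoidHom.mk' (fun τ => ⟨L.diff 1 0 τ, L.diff_diff hX rfl _⟩)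
        fun τ τ' => Subtype.ext (map_add (L.diff 1 0) (τ : BernoulliShift Γ _) τ'))
      ((hAB.comp continuous_subtype_val).subtype_mk _)
      (fun γ τ => Subtype.ext (L.diff_smul (b := 1) (c := 0) hX γ τ.1)) ?_ le_top fun τ => ?_
    · rintro ⟨τ, hτ⟩
      obtain ⟨σ, r, h⟩ := L.exists_diff_eq hX hexact rfl τ hτ
      refine ⟨⟨σ, trivial⟩, Subtype.ext ?_⟩
      funext γ s
      have hs := s.2
      exact ((h γ s).trans (if_neg (by omega))).symm
    · exact Subtype.ext_iff
  -- An even cocycle is a coboundary plus a constant on vertices; vanishing on the vertex orbit `v`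
  -- forces that constant to be zero.
  have h2 : H.h (L.cocycles hX 0 1) + H.h (L.reducedCocycles hX 1 0 v) =
      H.h (LinearSubshift.full Γ (L.Alphabet 0)) := by
    refine H.h_add_of_ker (φ₁ := LinearSubshift.full Γ (L.Alphabet 0))
      (AddMonoidHom.mk' (fun τ => ⟨L.diff 0 1 τ, L.diff_diff hX rfl _,
          fun γ => L.diff_vertex _ γ v hs₀⟩)
        fun τ τ' => Subtype.ext (map_add (L.diff 0 1) (τ : BernoulliShift Γ _) τ'))
      ((hBA.comp continuous_subtype_val).subtype_mk _)
      (fun γ τ => Subtype.ext (L.diff_smul (b := 0) (c := 1) hX γ τ.1)) ?_ le_top fun τ => ?_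
    · rintro ⟨τ, hτ, hτ0⟩
      obtain ⟨σ, r, h⟩ := L.exists_diff_eq hX hexact rfl τ hτ
      have hr : r = 0 := by
        rw [← hτ0 1, h 1 v, if_pos hs₀]
      refine ⟨⟨σ, trivial⟩, Subtype.ext ?_⟩
      funext γ s
      refine ((h γ s).trans ?_).symm
      split_ifs with hs
      · rw [hr]
        exact (L.diff_vertex σ γ s hs).symm
      · rfl
    · exact Subtype.ext_iff
  -- Evaluation on the orbit `v` reads off the constant, so the reduced cocycles have finite index.
  have h3 : H.h (L.reducedCocycles hX 1 0 v) + H.h (LinearSubshift.const Γ (ZMod 2)) =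
      H.h (L.cocycles hX 1 0) := by
    have hconst : ∀ τ : (L.cocycles hX 1 0).Points, ∀ γ,
        (τ : BernoulliShift Γ (L.Alphabet 1)) γ v = (τ : BernoulliShift Γ (L.Alphabet 1)) 1 v := by
      rintro ⟨τ, hτ⟩ γ
      obtain ⟨σ, r, h⟩ := L.exists_diff_eq hX hexact rfl τ hτ
      exact ((h γ v).trans (if_pos hs₀)).trans ((h 1 v).trans (if_pos hs₀)).symm
    have hcont : Continuous fun (τ : BernoulliShift Γ (L.Alphabet 1)) =>
        ((fun γ => τ γ v) : BernoulliShift Γ (ZMod 2)) :=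
      BernoulliShift.continuous_of_forall_finite fun γ =>
        ⟨{γ}, Set.finite_singleton γ, fun τ τ' h => congrFun (h γ rfl) v⟩
    refine H.h_add_of_ker (φ₁ := L.cocycles hX 1 0)
      (AddMonoidHom.mk' (fun τ => ⟨fun γ => (τ : BernoulliShift Γ (L.Alphabet 1)) γ v, hconst τ⟩)
        fun τ τ' => rfl)
      ((hcont.comp continuous_subtype_val).subtype_mk _)
      (fun γ τ => rfl) ?_ inf_le_left fun τ => ?_
    · rintro ⟨τ, hτ⟩
      -- The coboundary of this augmentation cochain equals `τ 1` on vertices and zero on other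
      -- simplices: a cocycle realizing the constant.
      let f : Finset E → ZMod 2 := fun F => if F = ∅ then τ 1 else 0
      have hf0 : ∀ F ∈ X, F.card % 2 ≠ 1 → coboundary f F = 0 := by
        intro F _ hF
        refine Finset.sum_eq_zero fun x hx => if_neg fun h => ?_
        have h1 := Finset.card_erase_of_mem hx
        have h2 := Finset.card_pos.2 ⟨x, hx⟩
        rw [h, Finset.card_empty] at h1
        omega
      refine ⟨⟨L.restrict 1 (coboundary f), ?_⟩, Subtype.ext (funext fun γ => ?_)⟩
      · change L.diff 1 0 _ = 0
        rw [L.diff_restrict hX (by simp [coboundary]) hf0]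
        funext γ s
        exact coboundary_coboundary _ _
      · obtain ⟨x, hx⟩ := Finset.card_eq_one.1 ((L.card_simplex s₀ γ).trans hs₀)
        refine Eq.trans ?_ (hτ γ).symm
        change coboundary f (L.simplex s₀ γ) = τ 1
        simp [coboundary, hx, f]
    · exact Subtype.ext_iff.trans (funext_iff.trans ⟨fun h => ⟨τ.2, h⟩, fun h => h.2⟩)
  have h4 := H.h_finite _ (LinearSubshift.finite_const Γ (ZMod 2))
  have h5 : Real.logb 2 (Nat.card (L.Alphabet 1)) = Real.logb 2 (Nat.card (L.Alphabet 0)) := by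
    rw [← H.h_full, ← H.h_full]
    linarith
  have h6 : ∀ b, Real.logb 2 (Nat.card (L.Alphabet b)) = Nat.card (L.Orbits b) := by
    intro b
    rw [Nat.card_fun, Nat.card_zmod, Nat.cast_pow, Real.logb_pow]
    simp
  rw [h6, h6] at h5
  exact_mod_cast h5

end OrbitLabelling

/-- The labelling of the simplices of a covering space by the simplices of the base and the deck
transformations. -/
theorem exists_orbitLabelling {V : Type*} [NormedAddCommGroup V] [NormedSpace ℝ V]
    {K : Geometry.SimplicialComplex ℝ V} {Γ E : Type*} [Group Γ] [MulAction Γ E]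
    [TopologicalSpace E] [DecidableEq E] {p : E → K.space} (hp : IsQuotientCoveringMap p Γ) :
    ∃ L : OrbitLabelling Γ K.faces (liftedFaces p), ∀ s, L.card s = (s : Finset V).card := by
  have hsub : ∀ s : Finset V, ∀ x ∈ s, x ∈ convexHull ℝ (s : Set V) := fun s x hx =>
    subset_convexHull ℝ _ hx
  have hlift : ∀ s : K.faces, ∃ ℓ, IsSimplexLift p (s : Finset V) ℓ := by
    rintro ⟨s, hs⟩
    obtain ⟨x, hx⟩ := K.nonempty_of_mem_faces hs
    obtain ⟨e, he⟩ := hp.surjective ⟨x, K.subset_space hs hx⟩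
    obtain ⟨ℓ, hℓ, -⟩ := exists_isSimplexLift hp.isCoveringMap hs e (by
      rw [he]
      exact hsub s x hx)
    exact ⟨ℓ, hℓ⟩
  choose ℓ hℓ using hlift
  have := hp.isCancelSMul
  refine ⟨{
    simplex := fun s γ => (s : Finset V).image fun x => γ⁻¹ • ℓ s x
    card := fun s => (s : Finset V).card
    card_simplex := fun s γ => Finset.card_image_of_injOn
      (((hℓ s).smul hp γ⁻¹).injOn.mono (subset_convexHull ℝ _))
    card_pos := fun s => (K.nonempty_of_mem_faces s.2).card_pos
    mem := fun s γ => ⟨s, Or.inr s.2, _, (hℓ s).smul hp γ⁻¹, rfl⟩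
    injective := ?_
    exists_eq := ?_
    simplex_mul := fun s γ δ => by
      rw [Finset.image_image]
      refine Finset.image_congr fun x _ => ?_
      simp [mul_smul] }, fun s => rfl⟩
  · rintro ⟨s, γ⟩ ⟨s', γ'⟩ h
    obtain ⟨h1, h2⟩ := ((hℓ s).smul hp γ⁻¹).eq_of_image_eq hp.isCoveringMap
      ((hℓ s').smul hp γ'⁻¹) h
    obtain rfl : s = s' := Subtype.ext h1
    obtain ⟨x, hx⟩ := K.nonempty_of_mem_faces s.2
    rw [inv_injective (IsCancelSMul.right_cancel _ _ _ (h2 x (hsub _ x hx)))]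
  · rintro F ⟨s, hs, m, hm, rfl⟩ hne
    rw [Finset.image_nonempty] at hne
    obtain ⟨x, hx⟩ := hne
    have hsK : s ∈ K.faces := hs.resolve_left (by rintro rfl; simp at hx)
    have hpx : p (m x) = p (ℓ ⟨s, hsK⟩ x) := Subtype.ext
      ((hm.apply_eq x (hsub _ x hx)).trans ((hℓ ⟨s, hsK⟩).apply_eq x (hsub _ x hx)).symm)
    -- `Γ` is transitive on fibres, so a translate of the chosen lift agrees with `m` at one vertex,
    -- hence on the whole simplex.
    obtain ⟨γ, hγ⟩ := hp.apply_eq_iff_mem_orbit.1 hpx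
    refine ⟨⟨s, hsK⟩, γ⁻¹, Finset.image_congr fun y hy => ?_⟩
    rw [inv_inv]
    exact hm.eq_of_eq hp.isCoveringMap ((hℓ ⟨s, hsK⟩).smul hp γ) (hsub _ x hx) (hsub _ x hx)
      hγ.symm (hsub _ y hy) (hsub _ y hy)

theorem sum_neg_one_pow_card_sub_one {V : Type*} (A : Finset (Finset V))
    (hA : ∀ s ∈ A, s.Nonempty) :
    ∑ s ∈ A, (-1 : ℤ) ^ (s.card - 1) =
      (A.filter fun s => s.card % 2 = 1).card - (A.filter fun s => s.card % 2 = 0).card := by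
  rw [Finset.card_filter, Finset.card_filter, Nat.cast_sum, Nat.cast_sum, ← Finset.sum_sub_distrib]
  refine Finset.sum_congr rfl fun s hs => ?_
  have := (hA s hs).card_pos
  rcases Nat.mod_two_eq_zero_or_one s.card with h | h
  · rw [Odd.neg_one_pow (Nat.odd_iff.2 (by omega)), if_neg (by omega), if_pos h]
    rfl
  · rw [Even.neg_one_pow (Nat.even_iff.2 (by omega)), if_pos h, if_neg (by omega)]
    rfl

/-- If `Γ` is a group of finite type, `BΓ` a finite simplicial classifying space of it, and
`e(Γ) = χ(BΓ)` is nonzero, then `Γ` is not symbolically entropy additive. -/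
theorem mainTheorem1 {Γ : Type*} [Group Γ] (BΓ : FiniteClassifyingComplex Γ)
    (he : BΓ.eulerChar ≠ 0) : ¬ IsSEA Γ := by
  classical
  rintro ⟨H⟩
  refine he ?_
  obtain ⟨E, _, _, p, _, hp⟩ := BΓ.exists_contractible_cover
  obtain ⟨L, hL⟩ := exists_orbitLabelling hp
  have hfin : Finite BΓ.complex.faces := BΓ.finite_faces
  obtain ⟨s, hs, -⟩ := BΓ.complex.mem_space_iff.1
    (p (Classical.choice (inferInstance : Nonempty E))).2
  obtain ⟨x, hx⟩ := BΓ.complex.nonempty_of_mem_faces hs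
  -- A vertex of `BΓ` supplies the orbit on which cocycles are normalized; it exists because a
  -- contractible space is nonempty.
  have hxK : {x} ∈ BΓ.complex.faces :=
    BΓ.complex.down_closed hs (Finset.singleton_subset_iff.2 hx) (Finset.singleton_nonempty x)
  have hX : ∀ F ∈ liftedFaces p, ∀ x ∈ F, F.erase x ∈ liftedFaces p := fun F hF x _ =>
    liftedFaces_mono hF (Finset.erase_subset _ _)
  have key := L.natCard_orbits_eq hX
    (fun f hf => exists_coboundary_eq (fun z hz hbd =>
      exists_boundary_eq_of_contractible BΓ.finite_faces hp.isCoveringMap hz hbd) hf)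
    ⟨{x}, hxK⟩ (by rw [hL]; exact Finset.card_singleton x) H
  have hcard : ∀ b, Nat.card (L.Orbits b) =
      (BΓ.finite_faces.toFinset.filter fun s => s.card % 2 = b).card := by
    intro b
    have e : L.Orbits b ≃ {s // s ∈ BΓ.complex.faces ∧ s.card % 2 = b} :=
      (Equiv.subtypeEquivRight fun s => by rw [hL]).trans
        (Equiv.subtypeSubtypeEquivSubtypeInter (· ∈ BΓ.complex.faces) fun s => s.card % 2 = b)
    rw [Nat.card_congr e]
    exact Nat.subtype_card _ fun s => by simp
  rw [FiniteClassifyingComplex.eulerChar, sum_neg_one_pow_card_sub_one _ fun s hs =>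
    BΓ.complex.nonempty_of_mem_faces (BΓ.finite_faces.mem_toFinset.1 hs), ← hcard, ← hcard, key,
    sub_self]
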